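/- **Setting.** Let $\sigma>0$, $h\in\mathbb R$ and $p=e^h/(e^h+e^{-h})\in(0,1)$. For every dimension $d$ let $r\in\mathbb R^d$ with $|r|^2=d$, and let $\mu=p\,\mathcal N(r,\sigma^2\mathrm{Id})+(1-p)\,\mathcal N(-r,\sigma^2\mathrm{Id})$. For $\kappa>0$ consider the time dilation $$\tau_t=\Big(1-\frac{\kappa}{\sqrt d}\Big)2t\ \ (0\le t\le\tfrac12),\qquad \tau_t=\Big(1-\frac{\kappa}{\sqrt d}\Big)+\frac{\kappa}{\sqrt d}(2t-1)\ \ (\tfrac12\le t\le1),$$ the dilated variance exploding interpolant $I_t=\sqrt d(1-\tau_t)z+\tau_t a$ with $z\sim\mathcal N(0,\mathrm{Id}_d)$ and $a\sim\mu$ independent, and the velocity field $b_t(x)=\mathbb E[\dot I_t\mid I_t=x]$ (continuous version in $x$; at $t=\frac12$ the right derivative is used). Let $X^{\Delta t}$ be the Euler discretization of the probability flow ODE $\dot X_t=b_t(X_t)$, $X_0\sim\mathcal N(0,d\,\mathrm{Id}_d)$, on the uniform grid of $[0,1]$ with step size $\Delta t=1/(2N)$, $N\ge1$ (so that $t=\frac12$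 is a grid point), interpolated linearly between grid points. Put $M^{\Delta t,d}_t=r\cdot X^{\Delta t}_t/d$ and $X^\perp_t=X^{\Delta t}_t-M^{\Delta t,d}_t\,r$. Below, $\mathcal N(0,s^2\mathrm{Id}_{d-1})$ is the isotropic Gaussian law on $r^\perp$, and standard deviations are nonnegative. **Theorem 2 (Dilated VE captures $p$ and $\sigma^2$).** For every $\kappa>0$ the following holds. The limit $M_t=\lim_{\Delta t\to0}\lim_{d\to\infty}M^{\Delta t,d}_t$, $t\in[0,1]$, exists: there is a process $(M_t)_{t\in[0,1]}$ which is a function of its initial value $M_0\sim\mathcal N(0,1)$, such that for almost every value $m$ of $M_0$ and all starting points $x_d\in\mathbb R^d$ with $r\cdot x_d/d\to m$ the iterated limit of the magnetizations of the discretized paths started at $x_d$ is $M_t$ for each $t\in[0,1]$; and, for $X_0\sim\mathcal N(0,d\,\mathrm{Id}_d)$, the iterated limit also holds in law, jointly at any finitely many times. *First phase.* For $t\in[0,\frac12]$, $X^\perp_t\sim\mathcal N\big(0,d(\sigma^{\Delta t,d}_t)^2\mathrm{Id}_{d-1}\big)$ for all $d\ge 1$ and $\Delta t$, where $\lim_{\Delta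 t\to0}\lim_{d\to\infty}\sigma^{\Delta t,d}_t=1-2t$. Moreover, almost surely, $t\mapsto M_t$ is continuous on $[0,1]$ and for $t\in[0,\frac12)$ $$\dot M_t=\frac{-M_t+\tanh\!\Big(h+\frac{2tM_t}{(1-2t)^2}\Big)}{\frac12-t},\qquad M_0\sim\mathcal N(0,1),$$ and $M_{1/2}\sim p\,\delta_1+(1-p)\,\delta_{-1}$. *Second phase.* For $t\in[\frac12,1]$, $M_t=M_{1/2}$ almost surely (for all such $t$ at once), and $X^\perp_t\sim\mathcal N\big(0,(\sigma^{\kappa,\Delta t,d}_t)^2\mathrm{Id}_{d-1}\big)$ for all $d\ge 1$ and $\Delta t$, where $$\sigma^\kappa_t=\lim_{\Delta t\to0}\lim_{d\to\infty}\sigma^{\kappa,\Delta t,d}_t=\kappa\sqrt{\frac{\kappa^2(2-2t)^2+\sigma^2}{\kappa^2+\sigma^2}}.$$ In particular, $\lim_{\kappa\to\infty}\sigma^\kappa_1=\sigma$. -/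

import Mathlib

open MeasureTheory ProbabilityTheory Filter Topology

noncomputable section

namespace DilatedVE

/-- `ℝ^d` with its Euclidean structure. -/
abbrev Vec (d : ℕ) : Type := EuclideanSpace ℝ (Fin d)

/-- The Gaussian law `N(m, s² Id)` on `ℝ^d`. -/
def isoGaussian {d : ℕ} (m : Vec d) (s : ℝ) : Measure (Vec d) :=
  (stdGaussian (Vec d)).map (fun x => m + s • x)

/-- The Gaussian law `N(0, s² Id_{d-1})` on the orthogonal complement of `r`, seen as a measure
on `ℝ^d`. -/
def perpGaussian {d : ℕ} (r : Vec d) (s : ℝ) : Measure (Vec d) :=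
  (stdGaussian ↥(Submodule.span ℝ {r})ᗮ).map
    (fun v : ↥(Submodule.span ℝ {r})ᗮ => s • (v : Vec d))

/-- The Gaussian mixture `p N(r, σ² Id) + (1 - p) N(-r, σ² Id)`. -/
def mixture {d : ℕ} (p σ : ℝ) (r : Vec d) : Measure (Vec d) :=
  ENNReal.ofReal p • isoGaussian r σ + ENNReal.ofReal (1 - p) • isoGaussian (-r) σ

/-- The time dilation: the last window, of length `κ / √d`, is run through for
`t ∈ [1/2, 1]`. -/
def dilation (κ : ℝ) (d : ℕ) (t : ℝ) : ℝ :=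
  if t ≤ 1 / 2 then (1 - κ / √(d : ℝ)) * (2 * t)
  else (1 - κ / √(d : ℝ)) + κ / √(d : ℝ) * (2 * t - 1)

/-- The dilated variance exploding interpolant `√d (1 - τ_t) z + τ_t a`, with `ω = (z, a)`. -/
def interpolant (κ : ℝ) {d : ℕ} (t : ℝ) (ω : Vec d × Vec d) : Vec d :=
  (√(d : ℝ) * (1 - dilation κ d t)) • ω.1 + dilation κ d t • ω.2

/-- The time derivative of the interpolant. It is the right derivative, because the dilation has a
kink at `t = 1/2`; at every other time this is the usual derivative. -/
def interpolantDot (κ : ℝ) {d : ℕ} (t : ℝ) (ω : Vec d × Vec d) : Vec d :=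
  derivWithin (fun s => interpolant κ s ω) (Set.Ici t) t

/-- The joint law of `(z, a)`: independent, `z ∼ N(0, Id)` and `a` with the mixture law. -/
def pairLaw {d : ℕ} (p σ : ℝ) (r : Vec d) : Measure (Vec d × Vec d) :=
  (stdGaussian (Vec d)).prod (mixture p σ r)

/-- `f` is the continuous version of `x ↦ E[İ_t | I_t = x]`. -/
def IsVelocity {d : ℕ} (p σ κ : ℝ) (r : Vec d) (t : ℝ) (f : Vec d → Vec d) : Prop :=
  Continuous f ∧
    (fun ω => f (interpolant κ t ω)) =ᵐ[pairLaw p σ r]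
      (pairLaw p σ r)[interpolantDot κ t |
        MeasurableSpace.comap (interpolant κ t) inferInstance]

/-- The velocity field `b_t(x) = E[İ_t | I_t = x]` of the probability flow ODE (the continuous
version of this conditional expectation). -/
def velocity {d : ℕ} (p σ κ : ℝ) (r : Vec d) (t : ℝ) : Vec d → Vec d :=
  Classical.epsilon (IsVelocity p σ κ r t)

/-- The Euler iterates, with step size `δ`, of `Ẋ_t = b_t(X_t)` started at `x` at time `0`. -/
def eulerIter {d : ℕ} (b : ℝ → Vec d → Vec d) (δ : ℝ) (x : Vec d) : ℕ → Vec d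
  | 0 => x
  | k + 1 => eulerIter b δ x k + δ • b (k * δ) (eulerIter b δ x k)

/-- The Euler scheme at a time `t`, linear between consecutive grid points. -/
def euler {d : ℕ} (b : ℝ → Vec d → Vec d) (δ : ℝ) (x : Vec d) (t : ℝ) : Vec d :=
  eulerIter b δ x ⌊t / δ⌋₊ +
    (t - ⌊t / δ⌋₊ * δ) • b (⌊t / δ⌋₊ * δ) (eulerIter b δ x ⌊t / δ⌋₊)

/-- `X^{Δt}_t`, as a function of the starting point `x`: the discretized probability flow ODE on
the uniform grid of `[0, 1]` with step size `Δt = 1 / (2 N)`. -/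
def flow {d : ℕ} (p σ κ : ℝ) (r : Vec d) (N : ℕ) (x : Vec d) (t : ℝ) : Vec d :=
  euler (velocity p σ κ r) (1 / (2 * (N : ℝ))) x t

/-- The magnetization `r · x / d`. -/
def mag {d : ℕ} (r x : Vec d) : ℝ := inner ℝ r x / (d : ℝ)

/-- The part `x - (r · x / d) r` of `x` that is orthogonal to `r` (when `|r|² = d`). -/
def perp {d : ℕ} (r x : Vec d) : Vec d := x - mag r x • r

/-- `lim_{N → ∞} lim_{d → ∞} u N d = L`, the inner limits existing for all large `N`. -/
def IterLim (u : ℕ → ℕ → ℝ) (L : ℝ) : Prop :=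
  ∃ v : ℕ → ℝ, (∀ᶠ N in atTop, Tendsto (fun d => u N d) atTop (𝓝 (v N))) ∧
    Tendsto v atTop (𝓝 L)

end DilatedVE

end

open DilatedVE

/-!
The law of the interpolant is a mixture of two Gaussians centred at `± τ r` with the same
covariance, so the velocity field is explicit. Within a component, `İ` is an affine function of `I`
plus an independent centred term (a rotation of the pair of Gaussian vectors, `exists_rotation`);
the Cameron–Martin densities of the two components (`map_add_stdGaussian`) then combine the two
affine functions by Bayes' formula, and the posterior mean of the sign is a hyperbolic tangent
(`bayes_identity`, `velocity_eq`). The law of `I` charges every open set, so the continuous version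
is unique. It has the form `b_t(x) = c x + k tanh(h + g (r · x / d)) r`. Hence the magnetization of
the Euler path follows a closed scalar Euler recursion (`mag_flow`), and its orthogonal part is
multiplied by a deterministic scalar (`perp_flow`), which gives the Gaussian laws on the orthogonal
complement.

*Infinite dimension, fixed step.* In the first phase the coefficients converge to those of `Ṁ = (-M
+ tanh(h + 2tM / (1 - 2t)²)) / (1/2 - t)`. In the second phase the gain `g` diverges, and the
limiting field is `rate · (sgn M - M)` (`tendsto_magField`). This is discontinuous at `0`, but the
limiting scheme at time `1/2` is strictly increasing in its initial value, so it avoids `0` for all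
but one initial value (`ae_iter_half_ne`), and afterwards it keeps its sign (`iter_second`).

*Small step.* The first-phase equation is solved by the monotone transport from `N(0, 1)` to the
law of `(1 - 2t) Z + 2t ε`, where `ε` is an independent sign: `M_t = (1 - 2t) Y` with `w = 2t / (1
- 2t)` and `p Φ(Y - w) + (1 - p) Φ(Y + w) = Φ(m)` (`hasDerivAt_limMag`). As `t → 1/2` it tends to
`1` if `Φ(m) > 1 - p` and to `-1` if `Φ(m) < 1 - p`, which gives the law at time `1/2`. The Euler
scheme converges on `[0, T]` for `T < 1/2` by a Grönwall estimate (`euler_converges`). Near the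
singular time `1/2` the region `s M ≥ 1/2`, `s` being the selected sign, is invariant, and the last
step is `tanh(h + N (N - 1) M)`, so the scheme reaches `s` (`tendsto_iter_half`).

*Orthogonal part.* In the first phase the limiting scheme is exact, with value `1 - 2t`. The last
step of that phase cancels the leading order and leaves a factor of order `1 / √d`, so that `√d`
times the scalar tends to `κ` (`tendsto_last_factor`, `tendsto_perp_half`); from there the limiting
equation is linear with smooth coefficients, and its solution is `perpStd`.
-/

noncomputable section

namespace DilatedVE

/-! ### The hyperbolic tangent -/

lemma hasDerivAt_tanh (x : ℝ) : HasDerivAt Real.tanh (1 / Real.cosh x ^ 2) x := by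
  have h := (Real.hasDerivAt_sinh x).div (Real.hasDerivAt_cosh x) (Real.cosh_pos x).ne'
  have e : Real.tanh = Real.sinh / Real.cosh := by
    ext y; exact Real.tanh_eq_sinh_div_cosh y
  rw [e]
  have hn : Real.cosh x * Real.cosh x - Real.sinh x * Real.sinh x = 1 := by
    rw [← Real.cosh_sq_sub_sinh_sq x]; ring
  rwa [hn] at h

lemma continuous_tanh : Continuous Real.tanh :=
  continuous_iff_continuousAt.2 fun x => (hasDerivAt_tanh x).continuousAt

lemma strictMono_tanh : StrictMono Real.tanh := by
  refine strictMono_of_deriv_pos fun x => ?_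
  rw [(hasDerivAt_tanh x).deriv]
  have := Real.cosh_pos x
  positivity

lemma lipschitzWith_tanh : LipschitzWith 1 Real.tanh := by
  refine lipschitzWith_of_nnnorm_deriv_le (fun x => (hasDerivAt_tanh x).differentiableAt) fun x => ?_
  rw [(hasDerivAt_tanh x).deriv, ← NNReal.coe_le_coe, coe_nnnorm, Real.norm_of_nonneg (by positivity)]
  rw [NNReal.coe_one]
  exact (div_le_one (by have := Real.cosh_pos x; positivity)).2
    (one_le_pow₀ (Real.one_le_cosh x))

lemma abs_tanh_sub_le (x y : ℝ) : |Real.tanh x - Real.tanh y| ≤ |x - y| := by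
  simpa [Real.dist_eq] using lipschitzWith_tanh.dist_le_mul x y

lemma tendsto_tanh_atTop : Tendsto Real.tanh atTop (𝓝 1) := by
  have e : ∀ x, Real.tanh x = (1 - Real.exp (-x) ^ 2) / (1 + Real.exp (-x) ^ 2) := by
    intro x
    have h1 : Real.exp x * Real.exp (-x) = 1 := by rw [← Real.exp_add]; simp
    rw [Real.tanh_eq, div_eq_div_iff (by positivity) (by positivity)]
    linear_combination (2 * Real.exp (-x)) * h1
  have h0 : Tendsto (fun x : ℝ => Real.exp (-x)) atTop (𝓝 0) :=
    Real.tendsto_exp_neg_atTop_nhds_zero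
  have h1 : Tendsto (fun x : ℝ => (1 - Real.exp (-x) ^ 2) / (1 + Real.exp (-x) ^ 2)) atTop
      (𝓝 ((1 - 0 ^ 2) / (1 + 0 ^ 2))) := ((h0.pow 2).const_sub 1).div ((h0.pow 2).const_add 1) (by norm_num)
  simp_rw [show Real.tanh = _ from funext e]
  simpa using h1

lemma tendsto_tanh_atBot : Tendsto Real.tanh atBot (𝓝 (-1)) := by
  have := (tendsto_tanh_atTop.comp tendsto_neg_atBot_atTop).neg
  refine this.congr fun x => ?_
  simp

/-! ### Gaussian measures and regression within a component -/

/-- **Cameron–Martin formula** for the standard Gaussian law: the translate by `m` has density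
`exp (⟪m, x⟫ - |m|² / 2)`. -/
lemma map_add_stdGaussian {d : ℕ} (m : Vec d) :
    (stdGaussian (Vec d)).map (fun x => m + x) =
      (stdGaussian (Vec d)).withDensity
        (fun x => ENNReal.ofReal (Real.exp (inner ℝ m x - ‖m‖ ^ 2 / 2))) := by
  have key : ∀ t : Vec d, ∫ x, Complex.exp ((inner ℝ m x : ℝ) + (inner ℝ x t : ℝ) * Complex.I)
      ∂(stdGaussian (Vec d)) =
      Complex.exp ((‖m‖ ^ 2 / 2 : ℝ) + (inner ℝ m t : ℝ) * Complex.I - (‖t‖ ^ 2 / 2 : ℝ)) := by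
    intro t
    rw [← map_pi_eq_stdGaussian, integral_map (by fun_prop) (by fun_prop)]
    have h1 : ∀ x : Fin d → ℝ, Complex.exp ((inner ℝ m (WithLp.toLp 2 x) : ℝ) +
        (inner ℝ (WithLp.toLp 2 x) t : ℝ) * Complex.I) =
        ∏ i, Complex.exp ((m i + t i * Complex.I) * x i) := by
      intro x
      rw [← Complex.exp_sum]
      congr 1
      simp only [PiLp.inner_apply, RCLike.inner_apply, conj_trivial]
      push_cast
      rw [Finset.sum_mul, ← Finset.sum_add_distrib]
      exact Finset.sum_congr rfl fun i _ => by ring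
    simp_rw [h1]
    rw [integral_fintype_prod_eq_prod (f := fun i (x : ℝ) => Complex.exp ((m i + t i * Complex.I) * x))]
    have h2 : ∀ i, ∫ x : ℝ, Complex.exp ((m i + t i * Complex.I) * x) ∂(gaussianReal 0 1) =
        Complex.exp ((m i + t i * Complex.I) ^ 2 / 2) := by
      intro i
      have := complexMGF_id_gaussianReal (μ := 0) (v := 1) ((m i : ℂ) + t i * Complex.I)
      simpa [complexMGF] using this
    simp_rw [h2]
    rw [← Complex.exp_sum]
    congr 1
    rw [EuclideanSpace.real_norm_sq_eq, EuclideanSpace.real_norm_sq_eq]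
    simp only [PiLp.inner_apply, RCLike.inner_apply, conj_trivial]
    push_cast
    rw [Finset.sum_mul, Finset.sum_div, Finset.sum_div, ← Finset.sum_add_distrib,
      ← Finset.sum_sub_distrib]
    refine Finset.sum_congr rfl fun i _ => ?_
    ring_nf
    rw [Complex.I_sq]
    ring
  have hint : Integrable (fun x => Real.exp (inner ℝ m x - ‖m‖ ^ 2 / 2)) (stdGaussian (Vec d)) := by
    by_contra hni
    have hni' : ¬ Integrable (fun x => Complex.exp ((inner ℝ m x : ℝ) + (inner ℝ x (0 : Vec d) : ℝ)
        * Complex.I)) (stdGaussian (Vec d)) := by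
      intro hi
      apply hni
      have := hi.norm.const_mul (Real.exp (-(‖m‖ ^ 2 / 2)))
      refine this.congr (ae_of_all _ fun x => ?_)
      simp [Complex.norm_exp, ← Real.exp_add]
      ring
    have := key 0
    rw [integral_undef hni'] at this
    exact Complex.exp_ne_zero _ this.symm
  have : IsFiniteMeasure ((stdGaussian (Vec d)).withDensity
        (fun x => ENNReal.ofReal (Real.exp (inner ℝ m x - ‖m‖ ^ 2 / 2)))) :=
    isFiniteMeasure_withDensity_ofReal hint.2
  have : IsFiniteMeasure ((stdGaussian (Vec d)).map (fun x => m + x)) :=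
    inferInstance
  apply Measure.ext_of_charFun
  ext t
  rw [charFun_apply, charFun_apply, integral_map (by fun_prop) (by fun_prop),
    integral_withDensity_eq_integral_toReal_smul (by fun_prop) (by simp)]
  have e1 : ∫ x, Complex.exp ((inner ℝ (m + x) t : ℝ) * Complex.I) ∂(stdGaussian (Vec d)) =
      Complex.exp ((inner ℝ m t : ℝ) * Complex.I - (‖t‖ ^ 2 / 2 : ℝ)) := by
    have := charFun_stdGaussian t
    rw [charFun_apply] at this
    simp_rw [inner_add_left, Complex.ofReal_add, add_mul, Complex.exp_add]
    rw [integral_const_mul, this, ← Complex.exp_add]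
    push_cast
    ring_nf
  have e2 : ∀ x : Vec d, (ENNReal.ofReal (Real.exp (inner ℝ m x - ‖m‖ ^ 2 / 2))).toReal •
      Complex.exp ((inner ℝ x t : ℝ) * Complex.I) =
      Complex.exp (-(‖m‖ ^ 2 / 2 : ℝ)) *
        Complex.exp ((inner ℝ m x : ℝ) + (inner ℝ x t : ℝ) * Complex.I) := by
    intro x
    rw [ENNReal.toReal_ofReal (Real.exp_pos _).le, Complex.real_smul, Complex.ofReal_exp,
      ← Complex.exp_add, ← Complex.exp_add]
    push_cast
    ring_nf
  rw [e1]
  simp_rw [e2]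
  rw [integral_const_mul, key t, ← Complex.exp_add]
  congr 1
  ring

instance {d : ℕ} (m : Vec d) (s : ℝ) : IsProbabilityMeasure (isoGaussian m s) :=
  Measure.isProbabilityMeasure_map (by fun_prop)

instance {d : ℕ} : (stdGaussian (Vec d)).IsOpenPosMeasure := by
  have : (gaussianReal 0 1).IsOpenPosMeasure :=
    (gaussianReal_absolutelyContinuous' 0 one_ne_zero).isOpenPosMeasure
  rw [← map_pi_eq_stdGaussian]
  exact (PiLp.continuous_toLp 2 _).isOpenPosMeasure_map (WithLp.toLp_surjective 2)

/-- The rotated pair: for independent standard Gaussian `u`, `w`, the vectors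
`z = (A u - s B w) / √v` and `a = m + s (s B u + A w) / √v`, where `v = A² + B² s²`, have the same
joint law as `z ∼ N(0, Id)` and an independent `a ∼ N(m, s² Id)`, and `A z + B a = B m + √v u`. -/
lemma exists_rotation {d : ℕ} (m : Vec d) (s A B : ℝ) (hv : 0 < A ^ 2 + B ^ 2 * s ^ 2) :
    ((stdGaussian (Vec d)).prod (stdGaussian (Vec d))).map (fun ω : Vec d × Vec d =>
      ((A / √(A ^ 2 + B ^ 2 * s ^ 2)) • ω.1 - (s * B / √(A ^ 2 + B ^ 2 * s ^ 2)) • ω.2,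
        m + s • ((s * B / √(A ^ 2 + B ^ 2 * s ^ 2)) • ω.1 +
          (A / √(A ^ 2 + B ^ 2 * s ^ 2)) • ω.2))) =
      (stdGaussian (Vec d)).prod (isoGaussian m s) := by
  set v := A ^ 2 + B ^ 2 * s ^ 2
  have hsv : √v ≠ 0 := (Real.sqrt_pos.2 hv).ne'
  have hsq : (A / √v) ^ 2 + (s * B / √v) ^ 2 = 1 := by
    rw [div_pow, div_pow, Real.sq_sqrt hv.le, ← add_div, div_eq_one_iff_eq hv.ne']
    simp only [v]; ring
  set ζ : ℂ := ⟨A / √v, -(s * B / √v)⟩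
  have hζ : ‖ζ‖ = 1 := by
    rw [Complex.norm_eq_sqrt_sq_add_sq]
    simp [ζ, hsq]
  have hζ0 : ζ ≠ 0 := by rw [← norm_ne_zero_iff, hζ]; exact one_ne_zero
  have hcos : Real.cos (Complex.arg ζ) = A / √v := by
    rw [Complex.cos_arg hζ0, hζ, div_one]
  have hsin : Real.sin (Complex.arg ζ) = -(s * B / √v) := by
    rw [Complex.sin_arg, hζ, div_one]
  have hrot := IsGaussian.map_rotation_eq_self_of_forall_strongDual_eq_zero
    (μ := stdGaussian (Vec d)) (by simp) (Complex.arg ζ)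
  have hprod := Measure.map_prod_map (stdGaussian (Vec d)) (stdGaussian (Vec d)) measurable_id
    (show Measurable fun x : Vec d => m + s • x by fun_prop)
  rw [Measure.map_id] at hprod
  rw [isoGaussian, hprod]
  conv_rhs => rw [← hrot]
  rw [Measure.map_map (by fun_prop) (by fun_prop)]
  congr 1
  ext1 ω
  simp only [Function.comp_apply, ContinuousLinearMap.rotation_apply, Prod.map_apply, hcos, hsin, id]
  simp [sub_eq_add_neg]

/-- The interpolant `A z + B a` of `z ∼ N(0, Id)` and an independent `a ∼ N(m, s² Id)` is
Gaussian. -/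
lemma map_comb {d : ℕ} (m : Vec d) (s A B : ℝ) (hv : 0 < A ^ 2 + B ^ 2 * s ^ 2) :
    ((stdGaussian (Vec d)).prod (isoGaussian m s)).map
        (fun ω : Vec d × Vec d => A • ω.1 + B • ω.2) =
      (stdGaussian (Vec d)).map (fun u => B • m + √(A ^ 2 + B ^ 2 * s ^ 2) • u) := by
  have hsv : √(A ^ 2 + B ^ 2 * s ^ 2) ≠ 0 := (Real.sqrt_pos.2 hv).ne'
  have hs := Real.sq_sqrt hv.le
  rw [← exists_rotation m s A B hv, Measure.map_map (by fun_prop) (by fun_prop)]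
  set w := √(A ^ 2 + B ^ 2 * s ^ 2)
  have : ((fun ω : Vec d × Vec d => A • ω.1 + B • ω.2) ∘ fun ω : Vec d × Vec d =>
      ((A / w) • ω.1 - (s * B / w) • ω.2, m + s • ((s * B / w) • ω.1 + (A / w) • ω.2))) =
      (fun u => B • m + w • u) ∘ Prod.fst := by
    ext1 ω
    have e : w = A * (A / w) + B * s * (s * B / w) := by
      field_simp
      exact hs
    simp only [Function.comp_apply]
    conv_rhs => rw [e]
    module
  rw [this, ← Measure.map_map (by fun_prop) (by fun_prop), Measure.map_fst_prod]
  simp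

lemma integrable_id_isoGaussian {d : ℕ} (m : Vec d) (s : ℝ) :
    Integrable (fun x => x) (isoGaussian m s) := by
  rw [isoGaussian, integrable_map_measure (by fun_prop) (by fun_prop)]
  exact (integrable_const m).add (IsGaussian.integrable_id.smul s)

lemma integrable_lin {d : ℕ} (m : Vec d) (s A B : ℝ) :
    Integrable (fun ω : Vec d × Vec d => A • ω.1 + B • ω.2)
      ((stdGaussian (Vec d)).prod (isoGaussian m s)) := by
  have h1 : Integrable (fun ω : Vec d × Vec d => ω.1)
      ((stdGaussian (Vec d)).prod (isoGaussian m s)) :=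
    Integrable.comp_fst (f := fun x : Vec d => x) IsGaussian.integrable_id _
  have h2 : Integrable (fun ω : Vec d × Vec d => ω.2)
      ((stdGaussian (Vec d)).prod (isoGaussian m s)) :=
    Integrable.comp_snd (f := fun x : Vec d => x) (integrable_id_isoGaussian m s) _
  exact (h1.smul A).add (h2.smul B)

/-- The regression coefficient of `A' z + B' a` on `A z + B a`, within a Gaussian component with
standard deviation `s`. -/
def regr (s A B A' B' : ℝ) : ℝ := (A' * A + B' * B * s ^ 2) / (A ^ 2 + B ^ 2 * s ^ 2)

/-- For a single Gaussian component, the conditional expectation of `A' z + B' a` given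
`x = A z + B a` is the affine regression function `c x + (B' - B c) m`, stated through integrals
over the events `{x ∈ S}`. -/
lemma setIntegral_component {d : ℕ} (m : Vec d) (s A B A' B' : ℝ)
    (hv : 0 < A ^ 2 + B ^ 2 * s ^ 2) {S : Set (Vec d)} (hS : MeasurableSet S) :
    ∫ ω in (fun ω : Vec d × Vec d => A • ω.1 + B • ω.2) ⁻¹' S, (A' • ω.1 + B' • ω.2)
        ∂((stdGaussian (Vec d)).prod (isoGaussian m s)) =
      ∫ x in S, (regr s A B A' B' • x + (B' - B * regr s A B A' B') • m)
        ∂((stdGaussian (Vec d)).map (fun u => B • m + √(A ^ 2 + B ^ 2 * s ^ 2) • u)) := by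
  unfold regr
  have hsv : √(A ^ 2 + B ^ 2 * s ^ 2) ≠ 0 := (Real.sqrt_pos.2 hv).ne'
  have hs := Real.sq_sqrt hv.le
  rw [← exists_rotation m s A B hv, setIntegral_map (hS.preimage (by fun_prop)) (by fun_prop)
    (by fun_prop), setIntegral_map hS (by fun_prop) (by fun_prop)]
  set v := A ^ 2 + B ^ 2 * s ^ 2 with hvdef
  set w := √v
  have hset : (fun ω : Vec d × Vec d =>
      ((A / w) • ω.1 - (s * B / w) • ω.2, m + s • ((s * B / w) • ω.1 + (A / w) • ω.2))) ⁻¹'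
      ((fun ω : Vec d × Vec d => A • ω.1 + B • ω.2) ⁻¹' S) =
      ((fun u : Vec d => B • m + w • u) ⁻¹' S) ×ˢ Set.univ := by
    ext ω
    have e : w = A * (A / w) + B * s * (s * B / w) := by
      field_simp
      exact hs
    simp only [Set.mem_preimage, Set.mem_prod, Set.mem_univ, and_true]
    conv_rhs => rw [e]
    rw [iff_iff_eq]; congr 1; module
  rw [hset, ← Measure.prod_restrict, Measure.restrict_univ]
  set ν := (stdGaussian (Vec d)).restrict ((fun u : Vec d => B • m + w • u) ⁻¹' S)
  have hfun : ∀ ω : Vec d × Vec d, A' • ((A / w) • ω.1 - (s * B / w) • ω.2) +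
      B' • (m + s • ((s * B / w) • ω.1 + (A / w) • ω.2)) =
      (((A' * A + B' * B * s ^ 2) / v) • (B • m + w • ω.1) +
        (B' - B * ((A' * A + B' * B * s ^ 2) / v)) • m) +
      ((B' * s * A - A' * s * B) / w) • ω.2 := by
    intro ω
    have e1 : (A' * A + B' * B * s ^ 2) / v * w = A' * (A / w) + B' * s * (s * B / w) := by
      rw [← hs]; field_simp
    have e2 : (B' * s * A - A' * s * B) / w = -(A' * (s * B / w)) + B' * s * (A / w) := by
      field_simp; ring
    rw [smul_add _ (B • m), smul_smul _ w, e1, e2]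
    module
  have i1 : Integrable (fun u : Vec d => (((A' * A + B' * B * s ^ 2) / v) • (B • m + w • u) +
        (B' - B * ((A' * A + B' * B * s ^ 2) / v)) • m)) ν := by
    have : Integrable (fun x : Vec d => x) (stdGaussian (Vec d)) := IsGaussian.integrable_id
    exact ((((integrable_const _).fun_add (this.fun_smul w)).fun_smul _).fun_add
      (integrable_const _)).restrict
  have i2 : Integrable (fun u : Vec d => ((B' * s * A - A' * s * B) / w) • u)
      (stdGaussian (Vec d)) := IsGaussian.integrable_fun_id.fun_smul _
  simp_rw [hfun]
  rw [integral_add (i1.comp_fst (stdGaussian (Vec d))) (i2.comp_snd ν),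
    integral_fun_snd (fun u : Vec d => ((B' * s * A - A' * s * B) / w) • u),
    integral_fun_fst (fun u : Vec d => (((A' * A + B' * B * s ^ 2) / v) • (B • m + w • u) +
        (B' - B * ((A' * A + B' * B * s ^ 2) / v)) • m)), integral_smul,
    integral_id_stdGaussian]
  simp

/-- Under a nondegenerate Gaussian law with mean `B m`, integrals are integrals over the centred
law against the Cameron–Martin density. -/
lemma setIntegral_shift {d : ℕ} (m : Vec d) (w : ℝ) (hw : w ≠ 0) (B : ℝ) (g : Vec d → Vec d)
    (hg : Continuous g) {S : Set (Vec d)} (hS : MeasurableSet S) :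
    ∫ x in S, g x ∂((stdGaussian (Vec d)).map (fun u => B • m + w • u)) =
      ∫ u in (fun u : Vec d => w • u) ⁻¹' S,
        Real.exp (B / w * inner ℝ m u - (B / w) ^ 2 * ‖m‖ ^ 2 / 2) • g (w • u)
        ∂(stdGaussian (Vec d)) := by
  have e : (fun u : Vec d => B • m + w • u) =
      (fun u : Vec d => w • u) ∘ fun u => (B / w) • m + u := by
    ext1 u
    simp only [Function.comp_apply, smul_add, smul_smul]
    rw [mul_div_cancel₀ _ hw]
  rw [e, ← Measure.map_map (by fun_prop) (by fun_prop), map_add_stdGaussian,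
    setIntegral_map hS (by fun_prop) (by fun_prop),
    setIntegral_withDensity_eq_setIntegral_toReal_smul (by fun_prop) (by simp)
      _ (hS.preimage (by fun_prop))]
  refine integral_congr_ae (ae_of_all _ fun u => ?_)
  simp only
  rw [ENNReal.toReal_ofReal (Real.exp_pos _).le, inner_smul_left, norm_smul, mul_pow,
    Real.norm_eq_abs, sq_abs]
  simp

lemma integrable_shift {d : ℕ} (m : Vec d) (w : ℝ) (hw : w ≠ 0) (B : ℝ) (g : Vec d → Vec d)
    (hg : Continuous g)
    (hi : Integrable g ((stdGaussian (Vec d)).map (fun u => B • m + w • u))) :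
    Integrable (fun u : Vec d =>
        Real.exp (B / w * inner ℝ m u - (B / w) ^ 2 * ‖m‖ ^ 2 / 2) • g (w • u))
      (stdGaussian (Vec d)) := by
  have e : (fun u : Vec d => B • m + w • u) =
      (fun u : Vec d => w • u) ∘ fun u => (B / w) • m + u := by
    ext1 u
    simp only [Function.comp_apply, smul_add, smul_smul]
    rw [mul_div_cancel₀ _ hw]
  rw [e, ← Measure.map_map (by fun_prop) (by fun_prop), map_add_stdGaussian,
    integrable_map_measure (by fun_prop) (by fun_prop),
    integrable_withDensity_iff_integrable_smul' (by fun_prop) (by simp)] at hi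
  refine hi.congr (ae_of_all _ fun u => ?_)
  simp only [Function.comp_apply]
  rw [ENNReal.toReal_ofReal (Real.exp_pos _).le, inner_smul_left, norm_smul, mul_pow,
    Real.norm_eq_abs, sq_abs]
  simp

/-! ### The velocity field -/

/-- The conditional expectation of `A' z + B' a` given `x = A z + B a`, when `z ∼ N(0, Id)` and `a`
has the Gaussian mixture law with log-odds `2 h`. The factor `tanh` is the posterior mean of the
sign of the component. -/
def condMean {d : ℕ} (h s A B A' B' : ℝ) (r x : Vec d) : Vec d :=
  regr s A B A' B' • x + ((B' - B * regr s A B A' B') *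
    Real.tanh (h + B * inner ℝ r x / (A ^ 2 + B ^ 2 * s ^ 2))) • r

lemma continuous_condMean {d : ℕ} (h s A B A' B' : ℝ) (r : Vec d) :
    Continuous (condMean h s A B A' B' r) := by
  unfold condMean
  have h0 := continuous_tanh
  fun_prop

lemma pairLaw_eq {d : ℕ} (p σ : ℝ) (r : Vec d) :
    pairLaw p σ r = ENNReal.ofReal p • ((stdGaussian (Vec d)).prod (isoGaussian r σ)) +
      ENNReal.ofReal (1 - p) • ((stdGaussian (Vec d)).prod (isoGaussian (-r) σ)) := by
  unfold pairLaw mixture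
  rw [Measure.prod_add, Measure.prod_smul_right, Measure.prod_smul_right]

lemma isProbabilityMeasure_pairLaw {d : ℕ} {p : ℝ} (hp0 : 0 ≤ p) (hp1 : p ≤ 1) (σ : ℝ)
    (r : Vec d) : IsProbabilityMeasure (pairLaw p σ r) := by
  constructor
  rw [pairLaw_eq]
  simp only [Measure.coe_add, Measure.coe_smul, Pi.add_apply, Pi.smul_apply, measure_univ,
    smul_eq_mul, mul_one]
  rw [← ENNReal.ofReal_add hp0 (by linarith)]
  simp

lemma integrable_condMean_comp {d : ℕ} (h s A B A' B' : ℝ) (r m : Vec d) :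
    Integrable (fun ω : Vec d × Vec d => condMean h s A B A' B' r (A • ω.1 + B • ω.2))
      ((stdGaussian (Vec d)).prod (isoGaussian m s)) := by
  unfold condMean
  refine ((integrable_lin m s A B).fun_smul _).fun_add ?_
  refine Integrable.of_bound (C := |B' - B * regr s A B A' B'| * ‖r‖) ?_ (ae_of_all _ fun ω => ?_)
  · have h0 := continuous_tanh
    fun_prop
  · rw [norm_smul, Real.norm_eq_abs, abs_mul]
    gcongr
    exact mul_le_of_le_one_right (abs_nonneg _) (Real.abs_tanh_lt_one _).le

/-- With prior probabilities `p`, `1 - p` and likelihoods proportional to `exp y`, `exp (-y)`, the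
posterior mean of the sign is `tanh (h + y)`. -/
lemma posterior_tanh {p h : ℝ} (hp : p = Real.exp h / (Real.exp h + Real.exp (-h))) (y : ℝ) :
    p * Real.exp y - (1 - p) * Real.exp (-y) =
      (p * Real.exp y + (1 - p) * Real.exp (-y)) * Real.tanh (h + y) := by
  have hden : Real.exp h + Real.exp (-h) ≠ 0 := by positivity
  have hq : 1 - p = Real.exp (-h) / (Real.exp h + Real.exp (-h)) := by
    rw [hp]; field_simp; ring
  have h2 : Real.exp (h + y) + Real.exp (-(h + y)) ≠ 0 := by positivity
  rw [Real.tanh_eq, hq, hp, neg_add, Real.exp_add, Real.exp_add] at *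
  field_simp

/-- Bayes' formula for the two components: the Cameron–Martin densities reweight the two affine
regression functions into `condMean`. -/
lemma bayes_identity {d : ℕ} {p h : ℝ} (hp : p = Real.exp h / (Real.exp h + Real.exp (-h)))
    (s A B A' B' y : ℝ) (r x : Vec d)
    (hy : y = B * inner ℝ r x / (A ^ 2 + B ^ 2 * s ^ 2)) :
    (p * Real.exp y) • (regr s A B A' B' • x + (B' - B * regr s A B A' B') • r) +
      ((1 - p) * Real.exp (-y)) • (regr s A B A' B' • x + (B' - B * regr s A B A' B') • (-r)) =
    (p * Real.exp y + (1 - p) * Real.exp (-y)) • condMean h s A B A' B' r x := by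
  unfold condMean
  rw [← hy]
  have key := posterior_tanh hp y
  set k := B' - B * regr s A B A' B'
  have : (p * Real.exp y) • (regr s A B A' B' • x + k • r) +
      ((1 - p) * Real.exp (-y)) • (regr s A B A' B' • x + k • (-r)) =
      (p * Real.exp y + (1 - p) * Real.exp (-y)) • (regr s A B A' B' • x) +
        (k * (p * Real.exp y - (1 - p) * Real.exp (-y))) • r := by module
  rw [this, key]
  module

lemma setIntegral_pairLaw {d : ℕ} {p : ℝ} (hp0 : 0 ≤ p) (hp1 : p ≤ 1) {σ : ℝ}
    {r : Vec d} {f : Vec d × Vec d → Vec d}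
    (hf : ∀ m : Vec d, Integrable f ((stdGaussian (Vec d)).prod (isoGaussian m σ)))
    (S : Set (Vec d × Vec d)) :
    ∫ ω in S, f ω ∂(pairLaw p σ r) =
      p • ∫ ω in S, f ω ∂((stdGaussian (Vec d)).prod (isoGaussian r σ)) +
      (1 - p) • ∫ ω in S, f ω ∂((stdGaussian (Vec d)).prod (isoGaussian (-r) σ)) := by
  rw [pairLaw_eq, Measure.restrict_add, Measure.restrict_smul, Measure.restrict_smul,
    integral_add_measure, integral_smul_measure, integral_smul_measure,
    ENNReal.toReal_ofReal hp0, ENNReal.toReal_ofReal (by linarith)]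
  · exact (hf r).restrict.smul_measure ENNReal.ofReal_ne_top
  · exact (hf (-r)).restrict.smul_measure ENNReal.ofReal_ne_top

/-- `condMean` is a version of the conditional expectation under the mixture law. -/
lemma condExp_pairLaw {d : ℕ} {p h : ℝ} (hp : p = Real.exp h / (Real.exp h + Real.exp (-h)))
    (hp0 : 0 ≤ p) (hp1 : p ≤ 1) (σ A B A' B' : ℝ) (r : Vec d)
    (hv : 0 < A ^ 2 + B ^ 2 * σ ^ 2) :
    (fun ω : Vec d × Vec d => condMean h σ A B A' B' r (A • ω.1 + B • ω.2)) =ᵐ[pairLaw p σ r]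
      (pairLaw p σ r)[fun ω : Vec d × Vec d => A' • ω.1 + B' • ω.2 |
        MeasurableSpace.comap (fun ω : Vec d × Vec d => A • ω.1 + B • ω.2) inferInstance] := by
  have hP := isProbabilityMeasure_pairLaw hp0 hp1 σ r
  have hJ : Measurable (fun ω : Vec d × Vec d => A • ω.1 + B • ω.2) := by fun_prop
  have hint : ∀ f : Vec d × Vec d → Vec d,
      (∀ m : Vec d, Integrable f ((stdGaussian (Vec d)).prod (isoGaussian m σ))) →
      Integrable f (pairLaw p σ r) := by
    intro f hf
    rw [pairLaw_eq]
    exact ((hf r).smul_measure ENNReal.ofReal_ne_top).add_measure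
      ((hf (-r)).smul_measure ENNReal.ofReal_ne_top)
  have hf1 := fun m : Vec d => integrable_lin m σ A' B'
  have hcm := continuous_condMean h σ A B A' B' r
  have hf2 := fun m : Vec d => integrable_condMean_comp h σ A B A' B' r m
  refine ae_eq_condExp_of_forall_setIntegral_eq hJ.comap_le (hint _ hf1)
    (fun s _ _ => (hint _ hf2).integrableOn) ?_ ?_
  · rintro _ ⟨S, hS, rfl⟩ -
    have hw : √(A ^ 2 + B ^ 2 * σ ^ 2) ≠ 0 := (Real.sqrt_pos.2 hv).ne'
    have hsq := Real.sq_sqrt hv.le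
    rw [setIntegral_pairLaw hp0 hp1 hf2, setIntegral_pairLaw hp0 hp1 hf1]
    have e2 : ∀ m : Vec d, ∫ ω in (fun ω : Vec d × Vec d => A • ω.1 + B • ω.2) ⁻¹' S,
        condMean h σ A B A' B' r (A • ω.1 + B • ω.2)
          ∂((stdGaussian (Vec d)).prod (isoGaussian m σ)) =
        ∫ x in S, condMean h σ A B A' B' r x
          ∂((stdGaussian (Vec d)).map (fun u => B • m + √(A ^ 2 + B ^ 2 * σ ^ 2) • u)) := by
      intro m
      rw [← map_comb m σ A B hv, setIntegral_map hS hcm.aestronglyMeasurable hJ.aemeasurable]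
    have j2 : ∀ m : Vec d, Integrable (condMean h σ A B A' B' r)
        ((stdGaussian (Vec d)).map (fun u => B • m + √(A ^ 2 + B ^ 2 * σ ^ 2) • u)) := by
      intro m
      rw [← map_comb m σ A B hv, integrable_map_measure hcm.aestronglyMeasurable hJ.aemeasurable]
      exact hf2 m
    have hlin : ∀ m : Vec d, Continuous fun x : Vec d =>
        regr σ A B A' B' • x + (B' - B * regr σ A B A' B') • m := fun m => by fun_prop
    have j1 : ∀ m : Vec d, Integrable
        (fun x : Vec d => regr σ A B A' B' • x + (B' - B * regr σ A B A' B') • m)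
        ((stdGaussian (Vec d)).map (fun u => B • m + √(A ^ 2 + B ^ 2 * σ ^ 2) • u)) := by
      intro m
      rw [integrable_map_measure (hlin m).aestronglyMeasurable (by fun_prop)]
      have : Integrable (fun x : Vec d => x) (stdGaussian (Vec d)) := IsGaussian.integrable_fun_id
      exact (((integrable_const _).fun_add (this.fun_smul _)).fun_smul _).fun_add
        (integrable_const _)
    have e1 := fun m : Vec d => setIntegral_component m σ A B A' B' hv hS
    have k1 := fun m : Vec d => integrable_shift m _ hw B _ (hlin m) (j1 m)
    have k2 := fun m : Vec d => integrable_shift m _ hw B _ hcm (j2 m)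
    rw [e1, e1, e2, e2, setIntegral_shift _ _ hw _ _ hcm hS, setIntegral_shift _ _ hw _ _ hcm hS,
      setIntegral_shift _ _ hw _ _ (hlin _) hS, setIntegral_shift _ _ hw _ _ (hlin _) hS,
      ← integral_smul, ← integral_smul, ← integral_smul, ← integral_smul,
      ← integral_add ((k2 r).restrict.fun_smul _) ((k2 (-r)).restrict.fun_smul _),
      ← integral_add ((k1 r).restrict.fun_smul _) ((k1 (-r)).restrict.fun_smul _)]
    refine integral_congr_ae (ae_of_all _ fun u => ?_)
    set w := √(A ^ 2 + B ^ 2 * σ ^ 2)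
    have hy : B / w * inner ℝ r u = B * inner ℝ r (w • u) / (A ^ 2 + B ^ 2 * σ ^ 2) := by
      rw [← hsq, inner_smul_right]; field_simp
    have := bayes_identity hp σ A B A' B' _ r (w • u) hy
    simp only [inner_neg_left, norm_neg, mul_neg, sub_eq_add_neg _ ((B / w) ^ 2 * ‖r‖ ^ 2 / 2),
      Real.exp_add]
    generalize condMean h σ A B A' B' r (w • u) = F at this ⊢
    generalize regr σ A B A' B' • w • u = G at this ⊢
    set q := Real.exp (-((B / w) ^ 2 * ‖r‖ ^ 2 / 2))
    set y := B / w * inner ℝ r u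
    have h2 := congrArg (fun z => q • z) this
    linear_combination (norm := module) (-1 : ℝ) • h2
  · exact (hcm.stronglyMeasurable.comp_measurable (comap_measurable _)).aestronglyMeasurable

/-- The right derivative of the dilation. -/
def dilationDot (κ : ℝ) (d : ℕ) (t : ℝ) : ℝ :=
  if t < 1 / 2 then 2 * (1 - κ / √(d : ℝ)) else 2 * (κ / √(d : ℝ))

lemma hasDerivWithinAt_dilation (κ : ℝ) (d : ℕ) (t : ℝ) :
    HasDerivWithinAt (dilation κ d) (dilationDot κ d t) (Set.Ici t) t := by
  unfold dilationDot
  split_ifs with ht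
  · have h : HasDerivAt (fun s : ℝ => (1 - κ / √(d : ℝ)) * (2 * s)) (2 * (1 - κ / √(d : ℝ))) t := by
      have := ((hasDerivAt_id t).const_mul 2).const_mul (1 - κ / √(d : ℝ))
      simpa [mul_comm] using this
    refine (h.congr_of_eventuallyEq ?_).hasDerivWithinAt
    filter_upwards [eventually_lt_nhds ht] with s hs
    simp only [dilation, if_pos hs.le]
  · have h : HasDerivAt (fun s : ℝ => (1 - κ / √(d : ℝ)) + κ / √(d : ℝ) * (2 * s - 1))
        (2 * (κ / √(d : ℝ))) t := by
      have := ((((hasDerivAt_id t).const_mul 2).sub_const 1).const_mul (κ / √(d : ℝ))).const_add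
        (1 - κ / √(d : ℝ))
      simpa [mul_comm] using this
    refine h.hasDerivWithinAt.congr_of_mem (fun s hs => ?_) Set.self_mem_Ici
    have hs' : t ≤ s := hs
    rw [not_lt] at ht
    by_cases h2 : s ≤ 1 / 2
    · have : s = 1 / 2 := le_antisymm h2 (ht.trans hs')
      simp only [dilation, this]
      norm_num
    · simp only [dilation, if_neg h2]

lemma interpolantDot_eq (κ : ℝ) {d : ℕ} (t : ℝ) (ω : Vec d × Vec d) :
    interpolantDot κ t ω = (-(√(d : ℝ) * dilationDot κ d t)) • ω.1 + dilationDot κ d t • ω.2 := by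
  have h := hasDerivWithinAt_dilation κ d t
  have h2 : HasDerivWithinAt (fun s => interpolant κ s ω)
      ((√(d : ℝ) * (-(dilationDot κ d t))) • ω.1 + dilationDot κ d t • ω.2) (Set.Ici t) t :=
    (((h.const_sub 1).const_mul _).smul_const ω.1).add (h.smul_const ω.2)
  rw [interpolantDot, h2.derivWithin (uniqueDiffOn_Ici t t Set.self_mem_Ici), mul_neg]

/-- The variance, within a component, of each coordinate of the interpolant. -/
lemma variance_pos {d : ℕ} (hd : 1 ≤ d) {σ : ℝ} (hσ : 0 < σ) (τ : ℝ) :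
    0 < (√(d : ℝ) * (1 - τ)) ^ 2 + τ ^ 2 * σ ^ 2 := by
  have hd' : (0 : ℝ) < √(d : ℝ) := Real.sqrt_pos.2 (by exact_mod_cast hd)
  by_cases h : τ = 0
  · subst h; simp; positivity
  · positivity

lemma isVelocity_condMean {d : ℕ} (hd : 1 ≤ d) {p h σ : ℝ} (hσ : 0 < σ)
    (hp : p = Real.exp h / (Real.exp h + Real.exp (-h))) (κ : ℝ) (r : Vec d) (t : ℝ) :
    IsVelocity p σ κ r t (condMean h σ (√(d : ℝ) * (1 - dilation κ d t)) (dilation κ d t)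
      (-(√(d : ℝ) * dilationDot κ d t)) (dilationDot κ d t) r) := by
  have hp0 : 0 ≤ p := by rw [hp]; positivity
  have hp1 : p ≤ 1 := by
    rw [hp]; exact (div_le_one (by positivity)).2 (by linarith [Real.exp_pos (-h)])
  refine ⟨continuous_condMean _ _ _ _ _ _ _, ?_⟩
  rw [show (interpolantDot κ t : Vec d × Vec d → Vec d) = _ from funext (interpolantDot_eq κ t)]
  exact condExp_pairLaw hp hp0 hp1 σ _ _ _ _ r (variance_pos hd hσ _)

/-- The law of the interpolant charges every open set, so the continuous version of the
conditional expectation is unique. -/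
lemma IsVelocity.unique {d : ℕ} (hd : 1 ≤ d) {p σ : ℝ} (hσ : 0 < σ) (hp0 : 0 < p) {κ : ℝ}
    {r : Vec d} {t : ℝ} {f g : Vec d → Vec d} (hf : IsVelocity p σ κ r t f)
    (hg : IsVelocity p σ κ r t g) : f = g := by
  have hv := variance_pos hd hσ (dilation κ d t)
  have hJ : Measurable (interpolant κ t : Vec d × Vec d → Vec d) := by unfold interpolant; fun_prop
  have h1 : ∀ᵐ ω ∂((stdGaussian (Vec d)).prod (isoGaussian r σ)),
      f (interpolant κ t ω) = g (interpolant κ t ω) := by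
    have := hf.2.trans hg.2.symm
    rw [pairLaw_eq] at this
    have h2 := (ae_add_measure_iff.1 this).1
    rwa [Measure.ae_ennreal_smul_measure_iff (by simpa using hp0)] at h2
  have hset : MeasurableSet {x | f x = g x} := measurableSet_eq_fun hf.1.measurable hg.1.measurable
  have h2 := (ae_map_iff (p := fun x => f x = g x) hJ.aemeasurable hset).2 h1
  have h3 : ((stdGaussian (Vec d)).prod (isoGaussian r σ)).map (interpolant κ t) = _ :=
    map_comb r σ _ _ hv
  rw [h3] at h2
  have hw : √((√(d : ℝ) * (1 - dilation κ d t)) ^ 2 + dilation κ d t ^ 2 * σ ^ 2) ≠ 0 :=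
    (Real.sqrt_pos.2 hv).ne'
  generalize √((√(d : ℝ) * (1 - dilation κ d t)) ^ 2 + dilation κ d t ^ 2 * σ ^ 2) = w at *
  have : ((stdGaussian (Vec d)).map (fun u => dilation κ d t • r + w • u)).IsOpenPosMeasure := by
    refine Continuous.isOpenPosMeasure_map (by fun_prop) fun y => ⟨w⁻¹ • (y - dilation κ d t • r), ?_⟩
    simp [smul_smul, hw]
  exact (Continuous.ae_eq_iff_eq _ hf.1 hg.1).1 h2

/-- The velocity field in closed form. -/
lemma velocity_eq {d : ℕ} (hd : 1 ≤ d) {p h σ : ℝ} (hσ : 0 < σ)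
    (hp : p = Real.exp h / (Real.exp h + Real.exp (-h))) (κ : ℝ) (r : Vec d) (t : ℝ) :
    velocity p σ κ r t = condMean h σ (√(d : ℝ) * (1 - dilation κ d t)) (dilation κ d t)
      (-(√(d : ℝ) * dilationDot κ d t)) (dilationDot κ d t) r := by
  have hv := isVelocity_condMean hd hσ hp κ r t
  exact IsVelocity.unique hd hσ (by rw [hp]; positivity) (Classical.epsilon_spec ⟨_, hv⟩) hv

/-! ### Reduction to scalar Euler schemes -/

/-- The Euler iterates, with step size `δ`, of the scalar equation `ẏ = g t y`. -/
def iterR (g : ℝ → ℝ → ℝ) (δ x : ℝ) : ℕ → ℝ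
  | 0 => x
  | k + 1 => iterR g δ x k + δ * g (k * δ) (iterR g δ x k)

/-- The scalar Euler scheme at a time `t`, linear between consecutive grid points. -/
def eulerR (g : ℝ → ℝ → ℝ) (δ x t : ℝ) : ℝ :=
  iterR g δ x ⌊t / δ⌋₊ + (t - ⌊t / δ⌋₊ * δ) * g (⌊t / δ⌋₊ * δ) (iterR g δ x ⌊t / δ⌋₊)

/-- The common denominator `d (1 - τ)² + τ² σ²` of the coefficients of the velocity field. -/
def den (κ σ : ℝ) (d : ℕ) (t : ℝ) : ℝ :=
  d * (1 - dilation κ d t) ^ 2 + dilation κ d t ^ 2 * σ ^ 2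

/-- The coefficient of `x` in the velocity field. -/
def linCoef (κ σ : ℝ) (d : ℕ) (t : ℝ) : ℝ :=
  dilationDot κ d t * (dilation κ d t * σ ^ 2 - d * (1 - dilation κ d t)) / den κ σ d t

/-- The coefficient of the nonlinear term `tanh (⋯) r` in the velocity field. -/
def attCoef (κ σ : ℝ) (d : ℕ) (t : ℝ) : ℝ :=
  dilationDot κ d t * (d * (1 - dilation κ d t)) / den κ σ d t

/-- The factor of the magnetization inside the hyperbolic tangent. -/
def gainCoef (κ σ : ℝ) (d : ℕ) (t : ℝ) : ℝ := dilation κ d t * d / den κ σ d t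

/-- The closed scalar equation for the magnetization in dimension `d`. -/
def magField (h κ σ : ℝ) (d : ℕ) (t y : ℝ) : ℝ :=
  linCoef κ σ d t * y + attCoef κ σ d t * Real.tanh (h + gainCoef κ σ d t * y)

lemma den_eq (κ σ : ℝ) (d : ℕ) (t : ℝ) : den κ σ d t =
    (√(d : ℝ) * (1 - dilation κ d t)) ^ 2 + dilation κ d t ^ 2 * σ ^ 2 := by
  rw [den, mul_pow, Real.sq_sqrt (Nat.cast_nonneg d)]

lemma velocity_apply {d : ℕ} (hd : 1 ≤ d) {p h σ : ℝ} (hσ : 0 < σ)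
    (hp : p = Real.exp h / (Real.exp h + Real.exp (-h))) (κ : ℝ) (r x : Vec d) (t : ℝ) :
    velocity p σ κ r t x = linCoef κ σ d t • x +
      (attCoef κ σ d t * Real.tanh (h + gainCoef κ σ d t * mag r x)) • r := by
  have hv := variance_pos hd hσ (dilation κ d t)
  have hd0 : (d : ℝ) ≠ 0 := by positivity
  have hs := Real.sq_sqrt (Nat.cast_nonneg (α := ℝ) d)
  rw [velocity_eq hd hσ hp, condMean, ← den_eq]
  rw [← den_eq] at hv
  have e1 : regr σ (√(d : ℝ) * (1 - dilation κ d t)) (dilation κ d t)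
      (-(√(d : ℝ) * dilationDot κ d t)) (dilationDot κ d t) = linCoef κ σ d t := by
    rw [regr, linCoef, ← den_eq]
    congr 1
    linear_combination (-dilationDot κ d t * (1 - dilation κ d t)) * hs
  have e2 : dilationDot κ d t - dilation κ d t * linCoef κ σ d t = attCoef κ σ d t := by
    rw [linCoef, attCoef, eq_div_iff hv.ne', sub_mul, mul_assoc, div_mul_cancel₀ _ hv.ne', den]
    ring
  rw [e1, e2, gainCoef, mag]
  congr 5
  field_simp

lemma mag_comb {d : ℕ} (hd : 1 ≤ d) {r : Vec d} (hr : ‖r‖ ^ 2 = (d : ℝ)) (x y : Vec d) (a b c : ℝ) :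
    mag r (x + a • (b • y + c • r)) = mag r x + a * (b * mag r y + c) := by
  have hd0 : (d : ℝ) ≠ 0 := by positivity
  simp only [mag, inner_add_right, inner_smul_right, real_inner_self_eq_norm_sq, hr]
  field_simp

lemma perp_comb {d : ℕ} (hd : 1 ≤ d) {r : Vec d} (hr : ‖r‖ ^ 2 = (d : ℝ)) (x y : Vec d) (a b c : ℝ) :
    perp r (x + a • (b • y + c • r)) = perp r x + (a * b) • perp r y := by
  rw [perp, mag_comb hd hr, perp, perp]
  module

lemma mag_eulerIter {d : ℕ} (hd : 1 ≤ d) {p h σ : ℝ} (hσ : 0 < σ)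
    (hp : p = Real.exp h / (Real.exp h + Real.exp (-h))) (κ : ℝ) {r : Vec d}
    (hr : ‖r‖ ^ 2 = (d : ℝ)) (δ : ℝ) (x : Vec d) (k : ℕ) :
    mag r (eulerIter (velocity p σ κ r) δ x k) =
    iterR (magField h κ σ d) δ (mag r x) k := by
  induction k with
  | zero => rfl
  | succ k ih =>
    rw [eulerIter, velocity_apply hd hσ hp, mag_comb hd hr, iterR, ih, magField]

lemma perp_eulerIter {d : ℕ} (hd : 1 ≤ d) {p h σ : ℝ} (hσ : 0 < σ)
    (hp : p = Real.exp h / (Real.exp h + Real.exp (-h))) (κ : ℝ) {r : Vec d}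
    (hr : ‖r‖ ^ 2 = (d : ℝ)) (δ : ℝ) (x : Vec d) (k : ℕ) :
    perp r (eulerIter (velocity p σ κ r) δ x k) =
    iterR (fun t y => linCoef κ σ d t * y) δ 1 k • perp r x := by
  induction k with
  | zero => simp [eulerIter, iterR]
  | succ k ih =>
    rw [eulerIter, velocity_apply hd hσ hp, perp_comb hd hr, iterR, ih]
    module

/-- The magnetization of the Euler path solves a closed scalar Euler recursion. -/
lemma mag_flow {d : ℕ} (hd : 1 ≤ d) {p h σ : ℝ} (hσ : 0 < σ)
    (hp : p = Real.exp h / (Real.exp h + Real.exp (-h))) (κ : ℝ) {r : Vec d}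
    (hr : ‖r‖ ^ 2 = (d : ℝ)) (x : Vec d) (N : ℕ) (t : ℝ) :
    mag r (flow p σ κ r N x t) =
    eulerR (magField h κ σ d) (1 / (2 * (N : ℝ))) (mag r x) t := by
  rw [flow, euler, velocity_apply hd hσ hp, mag_comb hd hr, eulerR, mag_eulerIter hd hσ hp κ hr,
    magField]

/-- The orthogonal part of the Euler path is a deterministic multiple of its initial value. -/
lemma perp_flow {d : ℕ} (hd : 1 ≤ d) {p h σ : ℝ} (hσ : 0 < σ)
    (hp : p = Real.exp h / (Real.exp h + Real.exp (-h))) (κ : ℝ) {r : Vec d}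
    (hr : ‖r‖ ^ 2 = (d : ℝ)) (x : Vec d) (N : ℕ) (t : ℝ) :
    perp r (flow p σ κ r N x t) =
    eulerR (fun t y => linCoef κ σ d t * y) (1 / (2 * (N : ℝ))) 1 t • perp r x := by
  rw [flow, euler, velocity_apply hd hσ hp, perp_comb hd hr, eulerR, perp_eulerIter hd hσ hp κ hr]
  module

lemma perp_eq_starProjection {d : ℕ} {r : Vec d} (hr : ‖r‖ ^ 2 = (d : ℝ)) (x : Vec d) :
    perp r x = (Submodule.span ℝ {r})ᗮ.starProjection x := by
  rw [Submodule.starProjection_orthogonal_val, Submodule.starProjection_singleton, perp, mag, ← hr]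
  simp

/-- The orthogonal part of `c X`, for `X ∼ N(0, d Id)`, is `N(0, d c² Id_{d-1})`. -/
lemma map_smul_perp {d : ℕ} {r : Vec d} (hr : ‖r‖ ^ 2 = (d : ℝ)) (c : ℝ) :
    (isoGaussian (0 : Vec d) √(d : ℝ)).map (fun x => c • perp r x) =
      perpGaussian r (√(d : ℝ) * |c|) := by
  set F := (Submodule.span ℝ {r})ᗮ
  have hperp : perp r = F.starProjection := funext (perp_eq_starProjection hr)
  rw [isoGaussian, perpGaussian, hperp, Measure.map_map (by fun_prop) (by fun_prop)]
  have m1 : Measurable ((fun x : Vec d => c • F.starProjection x) ∘ fun x => 0 + √(d : ℝ) • x) := by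
    fun_prop
  have m2 : Measurable (fun v : F => (√(d : ℝ) * |c|) • (v : Vec d)) := by fun_prop
  have := Measure.isProbabilityMeasure_map (μ := stdGaussian (Vec d)) m1.aemeasurable
  have := Measure.isProbabilityMeasure_map (μ := stdGaussian F) m2.aemeasurable
  apply Measure.ext_of_charFun
  ext t
  rw [charFun_apply, charFun_apply, integral_map m1.aemeasurable (by fun_prop),
    integral_map m2.aemeasurable (by fun_prop)]
  have h1 : ∀ x : Vec d, inner ℝ (((fun x : Vec d => c • F.starProjection x) ∘
      fun x => 0 + √(d : ℝ) • x) x) t = inner ℝ x ((c * √(d : ℝ)) • F.starProjection t) := by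
    intro x
    simp only [Function.comp_apply, zero_add, map_smul, inner_smul_left, inner_smul_right,
      Submodule.inner_starProjection_left_eq_right]
    simp [mul_assoc]
  have h2 : ∀ v : F, inner ℝ ((√(d : ℝ) * |c|) • (v : Vec d)) t =
      inner ℝ v ((√(d : ℝ) * |c|) • F.orthogonalProjectionOnto t) := by
    intro v
    rw [inner_smul_left, inner_smul_right, Submodule.coe_inner, ← Submodule.starProjection_apply,
      ← Submodule.inner_starProjection_left_eq_right, Submodule.starProjection_eq_self_iff.2 v.2]
    simp
  simp_rw [h1, h2]
  rw [← charFun_apply, ← charFun_apply, charFun_stdGaussian, charFun_stdGaussian, norm_smul,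
    norm_smul, Submodule.starProjection_apply, Submodule.coe_norm]
  simp [mul_comm]

/-- The magnetization of `X ∼ N(0, d Id)` is standard Gaussian. -/
lemma map_mag {d : ℕ} (hd : 1 ≤ d) {r : Vec d} (hr : ‖r‖ ^ 2 = (d : ℝ)) :
    (isoGaussian (0 : Vec d) √(d : ℝ)).map (mag r) = gaussianReal 0 1 := by
  have hd0 : (0 : ℝ) < d := by positivity
  have hmag : Measurable (mag r) := by unfold mag; fun_prop
  rw [isoGaussian, Measure.map_map hmag (by fun_prop)]
  have m1 : Measurable (mag r ∘ fun x => 0 + √(d : ℝ) • x) := hmag.comp (by fun_prop)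
  have := Measure.isProbabilityMeasure_map (μ := stdGaussian (Vec d)) m1.aemeasurable
  apply Measure.ext_of_charFun
  ext t
  rw [charFun_apply, integral_map m1.aemeasurable (by fun_prop), charFun_gaussianReal]
  have h1 : ∀ x : Vec d, inner ℝ ((mag r ∘ fun x => 0 + √(d : ℝ) • x) x) t =
      inner ℝ x ((t * √(d : ℝ) / d) • r) := by
    intro x
    simp only [Function.comp_apply, zero_add, mag, inner_smul_right, real_inner_comm x r]
    simp
    ring
  simp_rw [h1]
  have h2 : ‖(t * √(d : ℝ) / d) • r‖ ^ 2 = t ^ 2 := by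
    rw [norm_smul, mul_pow, hr, Real.norm_eq_abs, sq_abs, div_pow, mul_pow, Real.sq_sqrt hd0.le]
    field_simp
  rw [← charFun_apply, charFun_stdGaussian, ← Complex.ofReal_pow, h2]
  congr 1
  simp [neg_div]

/-! ### Coefficients in the limit of infinite dimension -/

/-- The attraction rate, in the limit of infinite dimension, during the second phase. -/
def rate (κ σ t : ℝ) : ℝ := 2 * κ ^ 2 * (2 - 2 * t) / (κ ^ 2 * (2 - 2 * t) ^ 2 + σ ^ 2)

/-- The sign of a real number, with the value `-1` at `0`. -/
def sgn (y : ℝ) : ℝ := if 0 < y then 1 else -1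

/-- The field that drives the magnetization in the limit of infinite dimension. In the second phase
it is discontinuous at `y = 0`, where its value is immaterial. -/
def limField (h κ σ t y : ℝ) : ℝ :=
  if t < 1 / 2 then (-y + Real.tanh (h + 2 * t * y / (1 - 2 * t) ^ 2)) / (1 / 2 - t)
  else rate κ σ t * (sgn y - y)

lemma tendsto_inv_sqrt : Tendsto (fun d : ℕ => 1 / √(d : ℝ)) atTop (𝓝 0) :=
  tendsto_const_nhds.div_atTop (Real.tendsto_sqrt_atTop.comp tendsto_natCast_atTop_atTop)

lemma tendsto_ratio (κ : ℝ) : Tendsto (fun d : ℕ => κ / √(d : ℝ)) atTop (𝓝 0) :=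
  tendsto_const_nhds.div_atTop (Real.tendsto_sqrt_atTop.comp tendsto_natCast_atTop_atTop)

lemma tendsto_inv_dim : Tendsto (fun d : ℕ => 1 / (d : ℝ)) atTop (𝓝 0) :=
  tendsto_one_div_atTop_nhds_zero_nat

lemma dilation_first {κ : ℝ} {d : ℕ} {t : ℝ} (ht : t ≤ 1 / 2) :
    dilation κ d t = (1 - κ / √(d : ℝ)) * (2 * t) := if_pos ht

lemma dilation_second {κ : ℝ} {d : ℕ} {t : ℝ} (ht : 1 / 2 ≤ t) :
    dilation κ d t = 1 - κ / √(d : ℝ) * (2 - 2 * t) := by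
  unfold dilation
  split_ifs with h
  · have : t = 1 / 2 := le_antisymm h ht
    subst this; ring
  · ring

lemma dim_mul_ratio_sq {κ : ℝ} {d : ℕ} (hd : 1 ≤ d) : (d : ℝ) * (κ / √(d : ℝ)) ^ 2 = κ ^ 2 := by
  have hd0 : (d : ℝ) ≠ 0 := by positivity
  rw [div_pow, Real.sq_sqrt (Nat.cast_nonneg d)]
  field_simp

section FirstPhase

lemma tendsto_dilation_first (κ : ℝ) {t : ℝ} (ht : t ≤ 1 / 2) :
    Tendsto (fun d : ℕ => dilation κ d t) atTop (𝓝 (2 * t)) := by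
  simp_rw [dilation_first ht]
  simpa using ((tendsto_ratio κ).const_sub 1).mul_const (2 * t)

lemma tendsto_dilationDot_first (κ : ℝ) {t : ℝ} (ht : t < 1 / 2) :
    Tendsto (fun d : ℕ => dilationDot κ d t) atTop (𝓝 2) := by
  simp_rw [dilationDot, if_pos ht]
  simpa using ((tendsto_ratio κ).const_sub 1).const_mul 2

lemma tendsto_den_first (κ σ : ℝ) {t : ℝ} (ht : t < 1 / 2) :
    Tendsto (fun d : ℕ => den κ σ d t / d) atTop (𝓝 ((1 - 2 * t) ^ 2)) := by
  have h1 := tendsto_dilation_first κ ht.le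
  have h2 := ((h1.const_sub 1).pow 2).add (((h1.pow 2).mul_const (σ ^ 2)).mul tendsto_inv_dim)
  rw [mul_zero, add_zero] at h2
  refine h2.congr' ?_
  filter_upwards [eventually_ge_atTop 1] with d hd
  have hd0 : (d : ℝ) ≠ 0 := by positivity
  rw [den]
  field_simp

lemma tendsto_linCoef_first (κ σ : ℝ) {t : ℝ} (ht : t < 1 / 2) :
    Tendsto (fun d : ℕ => linCoef κ σ d t) atTop (𝓝 (-1 / (1 / 2 - t))) := by
  have h0 : 1 - 2 * t ≠ 0 := by linarith
  have h1 := tendsto_dilation_first κ ht.le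
  have h2 := (tendsto_dilationDot_first κ ht).mul
    (((h1.mul_const (σ ^ 2)).mul tendsto_inv_dim).sub (h1.const_sub 1))
  have h3 := h2.div (tendsto_den_first κ σ ht) (pow_ne_zero 2 h0)
  have e : 2 * (2 * t * σ ^ 2 * 0 - (1 - 2 * t)) / (1 - 2 * t) ^ 2 = -1 / (1 / 2 - t) := by
    have h0' : 1 / 2 - t ≠ 0 := by linarith
    rw [div_eq_div_iff (pow_ne_zero 2 h0) h0']; ring
  rw [e] at h3
  refine h3.congr' ?_
  filter_upwards [eventually_ge_atTop 1] with d hd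
  have hd0 : (d : ℝ) ≠ 0 := by positivity
  simp only [Pi.div_apply]
  rw [linCoef, div_div_eq_mul_div]
  congr 1
  field_simp

lemma tendsto_attCoef_first (κ σ : ℝ) {t : ℝ} (ht : t < 1 / 2) :
    Tendsto (fun d : ℕ => attCoef κ σ d t) atTop (𝓝 (1 / (1 / 2 - t))) := by
  have h0 : 1 - 2 * t ≠ 0 := by linarith
  have h1 := tendsto_dilation_first κ ht.le
  have h2 := (tendsto_dilationDot_first κ ht).mul (h1.const_sub 1)
  have h3 := h2.div (tendsto_den_first κ σ ht) (pow_ne_zero 2 h0)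
  have e : 2 * (1 - 2 * t) / (1 - 2 * t) ^ 2 = 1 / (1 / 2 - t) := by
    have h0' : 1 / 2 - t ≠ 0 := by linarith
    rw [div_eq_div_iff (pow_ne_zero 2 h0) h0']; ring
  rw [e] at h3
  refine h3.congr' ?_
  filter_upwards [eventually_ge_atTop 1] with d hd
  have hd0 : (d : ℝ) ≠ 0 := by positivity
  simp only [Pi.div_apply]
  rw [attCoef, div_div_eq_mul_div]
  congr 1
  ring

lemma tendsto_gainCoef_first (κ σ : ℝ) {t : ℝ} (ht : t < 1 / 2) :
    Tendsto (fun d : ℕ => gainCoef κ σ d t) atTop (𝓝 (2 * t / (1 - 2 * t) ^ 2)) := by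
  have h0 : 1 - 2 * t ≠ 0 := by linarith
  have h3 := (tendsto_dilation_first κ ht.le).div (tendsto_den_first κ σ ht) (pow_ne_zero 2 h0)
  refine h3.congr' ?_
  filter_upwards [eventually_ge_atTop 1] with d hd
  simp only [Pi.div_apply]
  rw [gainCoef, div_div_eq_mul_div]

/-- The rate at which the last Euler step of the first phase contracts the orthogonal part: the
step of length `1/2 - t` cancels the leading order, which leaves a factor of order `1 / √d`. -/
lemma tendsto_last_factor (κ σ : ℝ) {t : ℝ} (ht : t < 1 / 2) :
    Tendsto (fun d : ℕ => √(d : ℝ) * (1 + (1 / 2 - t) * linCoef κ σ d t)) atTop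
      (𝓝 (κ / (1 - 2 * t))) := by
  have h0 : 1 - 2 * t ≠ 0 := by linarith
  have h1 := tendsto_dilation_first κ ht.le
  have hden := tendsto_den_first κ σ ht
  have h2 := ((h1.const_sub 1).mul_const κ).add
    (((h1.const_mul (σ ^ 2)).mul ((tendsto_ratio κ).const_sub 1)).mul tendsto_inv_sqrt)
  have h3 := h2.div hden (pow_ne_zero 2 h0)
  have e : ((1 - 2 * t) * κ + σ ^ 2 * (2 * t) * (1 - 0) * 0) / (1 - 2 * t) ^ 2 =
      κ / (1 - 2 * t) := by
    field_simp; ring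
  rw [e] at h3
  refine h3.congr' ?_
  filter_upwards [eventually_ge_atTop 1, hden.eventually_ne (pow_ne_zero 2 h0)] with d hd hne
  have hd0 : (0 : ℝ) < d := by positivity
  have hs : √(d : ℝ) ≠ 0 := (Real.sqrt_pos.2 hd0).ne'
  have hs2 := Real.sq_sqrt hd0.le
  have hD : den κ σ d t ≠ 0 := fun hc => hne (by rw [hc, zero_div])
  simp only [Pi.div_apply]
  have hdot : dilationDot κ d t = 2 * (1 - κ / √(d : ℝ)) := if_pos ht
  have hdil := dilation_first (κ := κ) (d := d) ht.le
  rw [linCoef, div_eq_iff hne]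
  have e1 : √(d : ℝ) * (1 + (1 / 2 - t) * (dilationDot κ d t *
      (dilation κ d t * σ ^ 2 - d * (1 - dilation κ d t)) / den κ σ d t)) * (den κ σ d t / d) =
      √(d : ℝ) * (den κ σ d t + (1 / 2 - t) * (dilationDot κ d t *
      (dilation κ d t * σ ^ 2 - d * (1 - dilation κ d t)))) / d := by
    field_simp
  rw [e1, den, hdot]
  have hq : κ = κ / √(d : ℝ) * √(d : ℝ) := by field_simp
  set q := κ / √(d : ℝ)
  set τ := dilation κ d t
  set w := √(d : ℝ)
  rw [← hs2]
  rw [show (w ^ 2 * (1 - τ) ^ 2 + τ ^ 2 * σ ^ 2 + (1 / 2 - t) * (2 * (1 - q) *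
      (τ * σ ^ 2 - w ^ 2 * (1 - τ)))) = w ^ 2 * (1 - τ) * q + σ ^ 2 * τ * (1 - q) by
    rw [hdil]; ring]
  conv_lhs => rw [hq]
  field_simp

end FirstPhase

section SecondPhase

lemma rate_nonneg {κ σ t : ℝ} (ht : t ≤ 1) : 0 ≤ rate κ σ t := by
  unfold rate
  have : 0 ≤ 2 - 2 * t := by linarith
  positivity

lemma den_second {κ σ : ℝ} {d : ℕ} (hd : 1 ≤ d) {t : ℝ} (ht : 1 / 2 ≤ t) :
    den κ σ d t = κ ^ 2 * (2 - 2 * t) ^ 2 + dilation κ d t ^ 2 * σ ^ 2 := by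
  rw [den]
  congr 1
  rw [dilation_second ht, ← dim_mul_ratio_sq (κ := κ) hd]
  ring

lemma tendsto_dilation_second (κ : ℝ) {t : ℝ} (ht : 1 / 2 ≤ t) :
    Tendsto (fun d : ℕ => dilation κ d t) atTop (𝓝 1) := by
  simp_rw [dilation_second ht]
  simpa using ((tendsto_ratio κ).mul_const (2 - 2 * t)).const_sub 1

lemma tendsto_den_second (κ σ : ℝ) {t : ℝ} (ht : 1 / 2 ≤ t) :
    Tendsto (fun d : ℕ => den κ σ d t) atTop (𝓝 (κ ^ 2 * (2 - 2 * t) ^ 2 + σ ^ 2)) := by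
  have h := (((tendsto_dilation_second κ ht).pow 2).mul_const (σ ^ 2)).const_add
    (κ ^ 2 * (2 - 2 * t) ^ 2)
  rw [one_pow, one_mul] at h
  refine h.congr' ?_
  filter_upwards [eventually_ge_atTop 1] with d hd
  rw [den_second hd ht]

lemma limDen_pos {κ σ : ℝ} (hσ : 0 < σ) (t : ℝ) : 0 < κ ^ 2 * (2 - 2 * t) ^ 2 + σ ^ 2 := by
  positivity

lemma dilationDot_mul_dim {κ : ℝ} {d : ℕ} (hd : 1 ≤ d) {t : ℝ} (ht : 1 / 2 ≤ t) :
    dilationDot κ d t * (d * (1 - dilation κ d t)) = 2 * κ ^ 2 * (2 - 2 * t) := by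
  rw [dilationDot, if_neg (not_lt.2 ht), dilation_second ht, ← dim_mul_ratio_sq (κ := κ) hd]
  ring

lemma tendsto_attCoef_second (κ : ℝ) {σ : ℝ} (hσ : 0 < σ) {t : ℝ} (ht : 1 / 2 ≤ t) :
    Tendsto (fun d : ℕ => attCoef κ σ d t) atTop (𝓝 (rate κ σ t)) := by
  have h := (tendsto_const_nhds (x := 2 * κ ^ 2 * (2 - 2 * t))).div (tendsto_den_second κ σ ht)
    (limDen_pos hσ t).ne'
  refine h.congr' ?_
  filter_upwards [eventually_ge_atTop 1] with d hd
  simp only [Pi.div_apply]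
  rw [attCoef, dilationDot_mul_dim hd ht]

lemma tendsto_linCoef_second (κ : ℝ) {σ : ℝ} (hσ : 0 < σ) {t : ℝ} (ht : 1 / 2 ≤ t) :
    Tendsto (fun d : ℕ => linCoef κ σ d t) atTop (𝓝 (-rate κ σ t)) := by
  have h1 : Tendsto (fun d : ℕ => dilationDot κ d t) atTop (𝓝 0) := by
    simp_rw [dilationDot, if_neg (not_lt.2 ht)]
    simpa using (tendsto_ratio κ).const_mul 2
  have h2 := (h1.mul ((tendsto_dilation_second κ ht).mul_const (σ ^ 2))).div
    (tendsto_den_second κ σ ht) (limDen_pos hσ t).ne'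
  have h3 := h2.sub (tendsto_attCoef_second κ hσ ht)
  rw [zero_mul, zero_div, zero_sub] at h3
  refine h3.congr fun d => ?_
  simp only [Pi.div_apply]
  rw [attCoef, linCoef]
  ring

lemma tendsto_gainCoef_second (κ : ℝ) {σ : ℝ} (hσ : 0 < σ) {t : ℝ} (ht : 1 / 2 ≤ t) :
    Tendsto (fun d : ℕ => gainCoef κ σ d t) atTop atTop := by
  have h1 := (tendsto_dilation_second κ ht).div (tendsto_den_second κ σ ht) (limDen_pos hσ t).ne'
  have h2 := h1.pos_mul_atTop (div_pos one_pos (limDen_pos hσ t))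
    (tendsto_natCast_atTop_atTop (R := ℝ))
  refine h2.congr fun d => ?_
  simp only [Pi.div_apply]
  rw [gainCoef]
  ring

end SecondPhase

/-- The scalar field in dimension `d` converges to the limiting field. In the second phase the gain
diverges, and the hyperbolic tangent becomes a sign. -/
lemma tendsto_magField (h κ : ℝ) {σ : ℝ} (hσ : 0 < σ) {t : ℝ} {y : ℕ → ℝ} {y₀ : ℝ}
    (hy : Tendsto y atTop (𝓝 y₀)) (h0 : 1 / 2 ≤ t → y₀ ≠ 0) :
    Tendsto (fun d => magField h κ σ d t (y d)) atTop (𝓝 (limField h κ σ t y₀)) := by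
  unfold magField limField
  split_ifs with ht
  · have h1 := ((tendsto_linCoef_first κ σ ht).mul hy).add ((tendsto_attCoef_first κ σ ht).mul
      ((continuous_tanh.tendsto _).comp (((tendsto_gainCoef_first κ σ ht).mul hy).const_add h)))
    refine h1.congr' (Eventually.of_forall fun d => rfl) |>.trans_eq ?_
    rw [mul_div_right_comm]
    congr 1
    ring_nf
  · rw [not_lt] at ht
    have hy0 := h0 ht
    have h2 : Tendsto (fun d => Real.tanh (h + gainCoef κ σ d t * y d)) atTop (𝓝 (sgn y₀)) := by
      rcases lt_or_gt_of_ne hy0 with hneg | hpos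
      · rw [sgn, if_neg (not_lt.2 hneg.le)]
        exact tendsto_tanh_atBot.comp
          (tendsto_atBot_add_const_left _ _ ((tendsto_gainCoef_second κ hσ ht).atTop_mul_neg hneg hy))
      · rw [sgn, if_pos hpos]
        exact tendsto_tanh_atTop.comp
          (tendsto_atTop_add_const_left _ _ ((tendsto_gainCoef_second κ hσ ht).atTop_mul_pos hpos hy))
    have h3 := ((tendsto_linCoef_second κ hσ ht).mul hy).add
      ((tendsto_attCoef_second κ hσ ht).mul h2)
    convert h3 using 2
    ring

/-! ### Convergence of the Euler scheme -/

/-- One Euler step, of length at most `η`, propagates the error bound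
`ω (s - a) exp (K (s - a))`, where `ω` bounds the oscillation of `ẏ` at scale `η`. -/
lemma euler_step {a b K ω η : ℝ} (hK : 0 ≤ K) (hω : 0 ≤ ω) {g : ℝ → ℝ → ℝ} {y : ℝ → ℝ}
    (hg : ∀ t ∈ Set.Icc a b, ∀ u v, |g t u - g t v| ≤ K * |u - v|)
    (hy : ∀ t ∈ Set.Icc a b, HasDerivWithinAt y (g t (y t)) (Set.Icc a b) t)
    (hosc : ∀ s ∈ Set.Icc a b, ∀ t ∈ Set.Icc a b, |t - s| < η → |g t (y t) - g s (y s)| ≤ ω)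
    {s ρ x : ℝ} (hs : a ≤ s) (hρ : 0 ≤ ρ) (hρη : ρ < η) (hsb : s + ρ ≤ b)
    (hx : |x - y s| ≤ ω * (s - a) * Real.exp (K * (s - a))) :
    |x + ρ * g s x - y (s + ρ)| ≤ ω * (s + ρ - a) * Real.exp (K * (s + ρ - a)) := by
  have hsI : s ∈ Set.Icc a b := ⟨hs, by linarith⟩
  have hsub : Set.Icc s (s + ρ) ⊆ Set.Icc a b := Set.Icc_subset_Icc hs hsb
  have hloc : |y (s + ρ) - y s - ρ * g s (y s)| ≤ ω * ρ := by
    have hder : ∀ u ∈ Set.Icc s (s + ρ), HasDerivWithinAt (fun u => y u - u * g s (y s))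
        (g u (y u) - g s (y s)) (Set.Icc s (s + ρ)) u := by
      intro u hu
      have h1 := (hy u (hsub hu)).mono hsub
      have h2 := ((hasDerivAt_id u).mul_const (g s (y s))).hasDerivWithinAt (s := Set.Icc s (s + ρ))
      have h3 := h1.sub h2
      rw [one_mul] at h3
      exact h3
    have hb : ∀ u ∈ Set.Icc s (s + ρ), ‖g u (y u) - g s (y s)‖ ≤ ω := by
      intro u hu
      refine hosc s hsI u (hsub hu) ?_
      rw [abs_of_nonneg (by linarith [hu.1])]
      linarith [hu.2]
    have := Convex.norm_image_sub_le_of_norm_hasDerivWithin_le hder hb (convex_Icc _ _)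
      (Set.left_mem_Icc.2 (by linarith)) (Set.right_mem_Icc.2 (by linarith))
    rw [Real.norm_eq_abs, Real.norm_eq_abs, add_sub_cancel_left, abs_of_nonneg hρ] at this
    convert this using 2
    ring
  have hlip := hg s hsI x (y s)
  have htri : |x + ρ * g s x - y (s + ρ)| ≤ (1 + ρ * K) * |x - y s| + ω * ρ := by
    have e : x + ρ * g s x - y (s + ρ) = (x - y s) + ρ * (g s x - g s (y s)) -
      (y (s + ρ) - y s - ρ * g s (y s)) := by ring
    rw [e]
    refine (abs_sub _ _).trans ?_
    have h1 := abs_add_le (x - y s) (ρ * (g s x - g s (y s)))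
    rw [abs_mul, abs_of_nonneg hρ] at h1
    have h2 := mul_le_mul_of_nonneg_left hlip hρ
    linarith
  have hexp : 1 + ρ * K ≤ Real.exp (K * ρ) := by
    have := Real.add_one_le_exp (K * ρ); linarith
  have he : Real.exp (K * (s + ρ - a)) = Real.exp (K * ρ) * Real.exp (K * (s - a)) := by
    rw [← Real.exp_add]; ring_nf
  have h1 : 1 ≤ Real.exp (K * (s + ρ - a)) := Real.one_le_exp (by
    have : 0 ≤ s + ρ - a := by linarith
    positivity)
  have hsa : 0 ≤ s - a := by linarith
  calc _ ≤ (1 + ρ * K) * |x - y s| + ω * ρ := htri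
    _ ≤ Real.exp (K * ρ) * (ω * (s - a) * Real.exp (K * (s - a))) + ω * ρ *
          Real.exp (K * (s + ρ - a)) := by
        have h2 : ω * ρ ≤ ω * ρ * Real.exp (K * (s + ρ - a)) :=
          le_mul_of_one_le_right (by positivity) h1
        exact add_le_add (mul_le_mul hexp hx (abs_nonneg _) (Real.exp_pos _).le) h2
    _ = _ := by rw [he]; ring

/-- Convergence of the Euler scheme for a scalar equation whose right-hand side is Lipschitz in
space. The scheme may start at a later index `k₀`, at the grid point `k₀ δ = a`. -/
lemma euler_converges {a b K : ℝ} (hK : 0 ≤ K) (hab : a ≤ b) {g : ℝ → ℝ → ℝ} {y : ℝ → ℝ}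
    (hg : ∀ t ∈ Set.Icc a b, ∀ u v, |g t u - g t v| ≤ K * |u - v|)
    (hy : ∀ t ∈ Set.Icc a b, HasDerivWithinAt y (g t (y t)) (Set.Icc a b) t)
    (hc : ContinuousOn (fun t => g t (y t)) (Set.Icc a b)) {ε : ℝ} (hε : 0 < ε) :
    ∃ η > 0, ∀ δ, 0 < δ → δ < η → ∀ (e : ℕ → ℝ) (k₀ : ℕ), k₀ * δ = a → e k₀ = y a →
      (∀ k ≥ k₀, e (k + 1) = e k + δ * g (k * δ) (e k)) →
      ∀ t ∈ Set.Icc a b, ∀ k ≥ k₀, k * δ ≤ t → t ≤ (k + 1) * δ →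
        |e k + (t - k * δ) * g (k * δ) (e k) - y t| ≤ ε := by
  set ω := ε / ((b - a + 1) * Real.exp (K * (b - a)))
  have hpos : 0 < (b - a + 1) * Real.exp (K * (b - a)) :=
    mul_pos (by linarith) (Real.exp_pos _)
  have hω : 0 < ω := div_pos hε hpos
  have huc := isCompact_Icc.uniformContinuousOn_of_continuous hc
  obtain ⟨η, hη, hosc⟩ := Metric.uniformContinuousOn_iff_le.1 huc ω hω
  refine ⟨η, hη, fun δ hδ hδη e k₀ hk₀ he₀ hrec t ht k hk hkt htk => ?_⟩
  have hosc' : ∀ s ∈ Set.Icc a b, ∀ t ∈ Set.Icc a b, |t - s| < η → |g t (y t) - g s (y s)| ≤ ω :=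
    fun s hs t ht hst => hosc t ht s hs hst.le
  have hE : ∀ j ≥ k₀, j * δ ≤ b →
      |e j - y (j * δ)| ≤ ω * (j * δ - a) * Real.exp (K * (j * δ - a)) := by
    intro j hj
    induction j, hj using Nat.le_induction with
    | base => intro _; rw [hk₀, he₀]; simp
    | succ j hj ih =>
      intro hjb
      push_cast at hjb ⊢
      rw [add_mul, one_mul] at hjb ⊢
      have hja : a ≤ j * δ := by
        rw [← hk₀]; gcongr
      have := euler_step hK hω.le hg hy hosc' hja hδ.le hδη hjb (ih (by linarith))
      rwa [hrec j hj]
  have hka : a ≤ k * δ := by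
    rw [← hk₀]; gcongr
  have := euler_step hK hω.le hg hy hosc' hka (sub_nonneg.2 hkt)
    (by rw [add_mul, one_mul] at htk; linarith) (by linarith [ht.2]) (hE k hk (hkt.trans ht.2))
  rw [add_sub_cancel] at this
  refine this.trans ?_
  have hta : 0 ≤ t - a := by linarith [ht.1]
  calc ω * (t - a) * Real.exp (K * (t - a))
      ≤ ω * (b - a + 1) * Real.exp (K * (b - a)) := by
        have := ht.2
        gcongr
        linarith
    _ = ε := by rw [mul_assoc]; exact div_mul_cancel₀ _ hpos.ne'

/-! ### The limiting magnetization -/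

/-- The distribution function of the standard normal law. -/
def normalCdf (x : ℝ) : ℝ := cdf (gaussianReal 0 1) x

lemma hasDerivAt_normalCdf (x : ℝ) : HasDerivAt normalCdf (gaussianPDFReal 0 1 x) x := by
  have hcont : Continuous (gaussianPDFReal 0 1) := by unfold gaussianPDFReal; fun_prop
  have hint : ∀ s, IntegrableOn (gaussianPDFReal 0 1) s := fun s =>
    (integrable_gaussianPDFReal 0 1).integrableOn
  have e : ∀ y, normalCdf y = normalCdf 0 + ∫ u in (0 : ℝ)..y, gaussianPDFReal 0 1 u := by
    have h1 : ∀ y, normalCdf y = ∫ u in Set.Iic y, gaussianPDFReal 0 1 u := by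
      intro y
      rw [normalCdf, cdf_eq_real, Measure.real, gaussianReal_apply_eq_integral _ one_ne_zero,
        ENNReal.toReal_ofReal]
      exact setIntegral_nonneg measurableSet_Iic fun u _ => gaussianPDFReal_nonneg 0 1 u
    intro y
    rw [h1, h1, ← intervalIntegral.integral_Iic_sub_Iic (hint _) (hint _)]
    ring
  rw [show normalCdf = _ from funext e]
  exact (intervalIntegral.integral_hasDerivAt_right (hcont.intervalIntegrable _ _)
    (hcont.stronglyMeasurableAtFilter _ _) hcont.continuousAt).const_add _

lemma continuous_normalCdf : Continuous normalCdf :=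
  continuous_iff_continuousAt.2 fun x => (hasDerivAt_normalCdf x).continuousAt

lemma strictMono_normalCdf : StrictMono normalCdf := by
  refine strictMono_of_deriv_pos fun x => ?_
  rw [(hasDerivAt_normalCdf x).deriv]
  exact gaussianPDFReal_pos 0 1 x one_ne_zero

lemma tendsto_normalCdf_atBot : Tendsto normalCdf atBot (𝓝 0) := tendsto_cdf_atBot _

lemma tendsto_normalCdf_atTop : Tendsto normalCdf atTop (𝓝 1) := tendsto_cdf_atTop _

/-- The distribution function of the mixture `p N(w, 1) + (1 - p) N(-w, 1)`. -/
def mixCdf (p w y : ℝ) : ℝ := p * normalCdf (y - w) + (1 - p) * normalCdf (y + w)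

lemma strictMono_mixCdf {p : ℝ} (hp0 : 0 < p) (hp1 : p < 1) (w : ℝ) :
    StrictMono (mixCdf p w) := by
  intro x y hxy
  have h1 := strictMono_normalCdf (show x - w < y - w by linarith)
  have h2 := strictMono_normalCdf (show x + w < y + w by linarith)
  have h3 : 0 < 1 - p := by linarith
  exact add_lt_add (mul_lt_mul_of_pos_left h1 hp0) (mul_lt_mul_of_pos_left h2 h3)

lemma exists_quantile {p : ℝ} (hp0 : 0 < p) (hp1 : p < 1) (w m : ℝ) :
    ∃ y ∈ Set.Icc (m - |w|) (m + |w|), mixCdf p w y = normalCdf m := by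
  have hcont : Continuous (mixCdf p w) := by
    have := continuous_normalCdf
    unfold mixCdf; fun_prop
  have hmono := strictMono_normalCdf.monotone
  have h3 : 0 ≤ 1 - p := by linarith
  have hw1 := le_abs_self w
  have hw2 := neg_abs_le w
  refine intermediate_value_Icc (by linarith [abs_nonneg w]) hcont.continuousOn ⟨?_, ?_⟩
  · have h1 := mul_le_mul_of_nonneg_left (hmono (show m - |w| - w ≤ m by linarith)) hp0.le
    have h2 := mul_le_mul_of_nonneg_left (hmono (show m - |w| + w ≤ m by linarith)) h3
    unfold mixCdf; linarith
  · have h1 := mul_le_mul_of_nonneg_left (hmono (show m ≤ m + |w| - w by linarith)) hp0.le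
    have h2 := mul_le_mul_of_nonneg_left (hmono (show m ≤ m + |w| + w by linarith)) h3
    unfold mixCdf; linarith

/-- The monotone transport map from `N(0, 1)` to `p N(w, 1) + (1 - p) N(-w, 1)`: the quantile
`y` with `p Φ(y - w) + (1 - p) Φ(y + w) = Φ(m)`. It is meaningful for `0 < p < 1`. -/
def quantile (p w m : ℝ) : ℝ := Classical.epsilon fun y => mixCdf p w y = normalCdf m

section
variable {p : ℝ}

lemma mixCdf_quantile (hp0 : 0 < p) (hp1 : p < 1) (w m : ℝ) :
    mixCdf p w (quantile p w m) = normalCdf m := by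
  obtain ⟨y, -, hy⟩ := exists_quantile hp0 hp1 w m
  exact Classical.epsilon_spec (p := fun y => mixCdf p w y = normalCdf m) ⟨y, hy⟩

lemma quantile_mem (hp0 : 0 < p) (hp1 : p < 1) (w m : ℝ) :
    quantile p w m ∈ Set.Icc (m - |w|) (m + |w|) := by
  obtain ⟨y, hy1, hy⟩ := exists_quantile hp0 hp1 w m
  have : quantile p w m = y :=
    (strictMono_mixCdf hp0 hp1 w).injective ((mixCdf_quantile hp0 hp1 w m).trans hy.symm)
  rwa [this]

lemma quantile_zero (hp0 : 0 < p) (hp1 : p < 1) (m : ℝ) : quantile p 0 m = m := by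
  have := quantile_mem hp0 hp1 0 m
  simpa using this

lemma strictMono_quantile (hp0 : 0 < p) (hp1 : p < 1) (w : ℝ) : StrictMono (quantile p w) := by
  intro m m' hm
  rw [← (strictMono_mixCdf hp0 hp1 w).lt_iff_lt, mixCdf_quantile hp0 hp1, mixCdf_quantile hp0 hp1]
  exact strictMono_normalCdf hm

/-- The Gaussian densities at `y ∓ w` weigh the two components as in `posterior_tanh`. -/
lemma posterior_pdf {h : ℝ} (hp : p = Real.exp h / (Real.exp h + Real.exp (-h))) (w y : ℝ) :
    p * gaussianPDFReal 0 1 (y - w) - (1 - p) * gaussianPDFReal 0 1 (y + w) =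
      (p * gaussianPDFReal 0 1 (y - w) + (1 - p) * gaussianPDFReal 0 1 (y + w)) *
        Real.tanh (h + w * y) := by
  have e1 : gaussianPDFReal 0 1 (y - w) =
      gaussianPDFReal 0 1 y * Real.exp (-(w ^ 2 / 2)) * Real.exp (w * y) := by
    simp only [gaussianPDFReal, mul_assoc, ← Real.exp_add]
    congr 2; simp; ring
  have e2 : gaussianPDFReal 0 1 (y + w) =
      gaussianPDFReal 0 1 y * Real.exp (-(w ^ 2 / 2)) * Real.exp (-(w * y)) := by
    simp only [gaussianPDFReal, mul_assoc, ← Real.exp_add]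
    congr 2; simp; ring
  rw [e1, e2]
  linear_combination (gaussianPDFReal 0 1 y * Real.exp (-(w ^ 2 / 2))) * posterior_tanh hp (w * y)

/-- The transport map solves `dY/dw = tanh (h + w Y)`. Along the line of slope `μ ± ε` through a point
of the graph, the derivative of `mixCdf` is a positive multiple of `± ε`, so near that point the graph
lies between the two lines. -/
lemma hasDerivAt_quantile {h : ℝ} (hp : p = Real.exp h / (Real.exp h + Real.exp (-h)))
    (hp0 : 0 < p) (hp1 : p < 1) (w₀ m : ℝ) :
    HasDerivAt (fun w => quantile p w m) (Real.tanh (h + w₀ * quantile p w₀ m)) w₀ := by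
  set y₀ := quantile p w₀ m with hy₀
  set μ := Real.tanh (h + w₀ * y₀)
  set S := p * gaussianPDFReal 0 1 (y₀ - w₀) + (1 - p) * gaussianPDFReal 0 1 (y₀ + w₀) with hS
  have hSpos : 0 < S := by
    have h1 := gaussianPDFReal_pos 0 1 (y₀ - w₀) one_ne_zero
    have h2 := gaussianPDFReal_pos 0 1 (y₀ + w₀) one_ne_zero
    have h3 : 0 < 1 - p := by linarith
    positivity
  have hpost := posterior_pdf hp w₀ y₀
  -- the derivative of `mixCdf` along a line of slope `μ + ε` is `ε S`
  have hder : ∀ ε : ℝ, HasDerivAt (fun w => mixCdf p w (y₀ + (μ + ε) * (w - w₀))) (ε * S) w₀ := by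
    intro ε
    have hl : HasDerivAt (fun w : ℝ => y₀ + (μ + ε) * (w - w₀)) (μ + ε) w₀ := by
      have := (((hasDerivAt_id w₀).sub_const w₀).const_mul (μ + ε)).const_add y₀
      simpa using this
    have h1 := (hasDerivAt_normalCdf (y₀ - w₀)).comp_of_eq w₀ (hl.sub (hasDerivAt_id w₀))
      (by simp)
    have h2 := (hasDerivAt_normalCdf (y₀ + w₀)).comp_of_eq w₀ (hl.add (hasDerivAt_id w₀))
      (by simp)
    have h3 := (h1.const_mul p).add (h2.const_mul (1 - p))
    refine h3.congr_deriv ?_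
    linear_combination -hpost
  have hsign : ∀ ε > 0, ∀ᶠ w in 𝓝 w₀,
      |mixCdf p w (y₀ + (μ + ε) * (w - w₀)) - normalCdf m - ε * S * (w - w₀)| ≤
        ε * S / 2 * |w - w₀| ∧
      |mixCdf p w (y₀ + (μ - ε) * (w - w₀)) - normalCdf m + ε * S * (w - w₀)| ≤
        ε * S / 2 * |w - w₀| := by
    intro ε hε
    have hc : 0 < ε * S / 2 := by positivity
    have h1 := (hasDerivAt_iff_isLittleO.1 (hder ε)).def hc
    have h2 := (hasDerivAt_iff_isLittleO.1 (hder (-ε))).def hc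
    filter_upwards [h1, h2] with w hw1 hw2
    simp only [sub_self, mul_zero, add_zero, Real.norm_eq_abs, smul_eq_mul] at hw1 hw2
    rw [hy₀, mixCdf_quantile hp0 hp1, ← hy₀] at hw1 hw2
    constructor
    · convert hw1 using 2; ring
    · convert hw2 using 2; ring_nf
  rw [hasDerivAt_iff_isLittleO, Asymptotics.isLittleO_iff]
  intro ε hε
  filter_upwards [hsign ε hε] with w ⟨h1, h2⟩
  have hmono := strictMono_mixCdf hp0 hp1 w
  have hq := mixCdf_quantile hp0 hp1 w m
  rw [abs_le] at h1 h2
  rw [Real.norm_eq_abs, Real.norm_eq_abs, smul_eq_mul, abs_le]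
  have hc : 0 < ε * S := by positivity
  rcases le_total w₀ w with hw | hw
  · rw [abs_of_nonneg (sub_nonneg.2 hw)] at *
    have hnn : 0 ≤ ε * S / 2 * (w - w₀) := mul_nonneg (by positivity) (sub_nonneg.2 hw)
    have a1 : quantile p w m ≤ y₀ + (μ + ε) * (w - w₀) := by
      rw [← hmono.le_iff_le, hq]; linarith [h1.1]
    have a2 : y₀ + (μ - ε) * (w - w₀) ≤ quantile p w m := by
      rw [← hmono.le_iff_le, hq]; linarith [h2.2]
    constructor <;> linarith
  · rw [abs_of_nonpos (sub_nonpos.2 hw)] at *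
    have hnn : 0 ≤ ε * S / 2 * (w₀ - w) := mul_nonneg (by positivity) (sub_nonneg.2 hw)
    have a1 : y₀ + (μ + ε) * (w - w₀) ≤ quantile p w m := by
      rw [← hmono.le_iff_le, hq]; linarith [h1.2]
    have a2 : quantile p w m ≤ y₀ + (μ - ε) * (w - w₀) := by
      rw [← hmono.le_iff_le, hq]; linarith [h2.1]
    constructor <;> linarith

/-- The limiting magnetization. Before time `1/2` it is the monotone transport map from `N(0, 1)` to
the law of `(1 - 2t) Z + 2t ε`, for an independent sign `ε` with `P(ε = 1) = p`; from then on it is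
the sign that this transport selects. -/
def limMag (p m t : ℝ) : ℝ :=
  if t < 1 / 2 then (1 - 2 * t) * quantile p (2 * t / (1 - 2 * t)) m
  else if 1 - p < normalCdf m then 1 else -1

lemma limMag_zero (hp0 : 0 < p) (hp1 : p < 1) (m : ℝ) : limMag p m 0 = m := by
  simp [limMag, quantile_zero hp0 hp1]

lemma limMag_half {m t : ℝ} (ht : 1 / 2 ≤ t) : limMag p m t = limMag p m (1 / 2) := by
  simp only [limMag, if_neg (not_lt.2 ht), lt_irrefl, if_false]

lemma hasDerivAt_limMag {h : ℝ} (hp : p = Real.exp h / (Real.exp h + Real.exp (-h)))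
    (hp0 : 0 < p) (hp1 : p < 1) (m : ℝ) {t : ℝ} (ht : t < 1 / 2) :
    HasDerivAt (limMag p m)
      ((-(limMag p m t) + Real.tanh (h + 2 * t * limMag p m t / (1 - 2 * t) ^ 2)) / (1 / 2 - t))
      t := by
  have h0 : 1 - 2 * t ≠ 0 := by linarith
  have h0' : 1 / 2 - t ≠ 0 := by linarith
  have hlin : HasDerivAt (fun t : ℝ => 1 - 2 * t) (-2) t := by
    simpa using ((hasDerivAt_id t).const_mul 2).const_sub 1
  have hw : HasDerivAt (fun t : ℝ => 2 * t / (1 - 2 * t)) (2 / (1 - 2 * t) ^ 2) t := by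
    have := (((hasDerivAt_id t).const_mul 2).div hlin h0)
    refine this.congr_deriv ?_
    simp only [id]
    congr 1; ring
  have hq := (hasDerivAt_quantile hp hp0 hp1 (2 * t / (1 - 2 * t)) m).comp t hw
  have hall := hlin.mul hq
  have hval : limMag p m t = (1 - 2 * t) * quantile p (2 * t / (1 - 2 * t)) m := if_pos ht
  refine (hall.congr_of_eventuallyEq ?_).congr_deriv ?_
  · filter_upwards [eventually_lt_nhds ht] with s hs
    exact if_pos hs
  · rw [hval]
    have e : 2 * t * ((1 - 2 * t) * quantile p (2 * t / (1 - 2 * t)) m) / (1 - 2 * t) ^ 2 =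
        2 * t / (1 - 2 * t) * quantile p (2 * t / (1 - 2 * t)) m := by
      field_simp
    rw [e, Function.comp_apply]
    have e2 : 1 / 2 - t = (1 - 2 * t) / 2 := by ring
    rw [e2]
    field_simp

/-- At the end of the first phase, the magnetization tends to the selected sign, unless `m` is the
separating value with `Φ(m) = 1 - p`. -/
lemma tendsto_limMag (hp0 : 0 < p) (hp1 : p < 1) {m : ℝ} (hm : normalCdf m ≠ 1 - p) :
    Tendsto (limMag p m) (𝓝[<] (1 / 2)) (𝓝 (limMag p m (1 / 2))) := by
  have hpq : 0 < 1 - p := by linarith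
  have hhalf : limMag p m (1 / 2) = if 1 - p < normalCdf m then 1 else -1 := by
    simp [limMag]
  have hlim : ∀ a b : ℝ, Tendsto (fun t : ℝ => a * (2 * t) + b * (1 - 2 * t)) (𝓝[<] (1 / 2))
      (𝓝 a) := by
    intro a b
    have : Continuous (fun t : ℝ => a * (2 * t) + b * (1 - 2 * t)) := by fun_prop
    have h := this.tendsto (1 / 2)
    simp only [mul_one_div_cancel (two_ne_zero' ℝ), mul_one, sub_self, mul_zero, add_zero] at h
    exact h.mono_left nhdsWithin_le_nhds
  have hnear : ∀ᶠ t : ℝ in 𝓝[<] (1 / 2), 0 < t ∧ t < 1 / 2 := by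
    have h1 : ∀ᶠ t : ℝ in 𝓝[<] (1 / 2), 0 < t :=
      nhdsWithin_le_nhds (eventually_gt_nhds (by norm_num))
    filter_upwards [h1, self_mem_nhdsWithin] with t a b using ⟨a, b⟩
  rcases lt_or_gt_of_ne hm with hlt | hgt
  · rw [hhalf, if_neg (not_lt.2 hlt.le)]
    have hr : normalCdf m / (1 - p) < 1 := (div_lt_one hpq).2 hlt
    obtain ⟨b, hb⟩ := (tendsto_normalCdf_atTop.eventually (eventually_gt_nhds hr)).exists
    refine tendsto_of_tendsto_of_tendsto_of_le_of_le' (hlim (-1) m) (hlim (-1) b) ?_ ?_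
    · filter_upwards [hnear] with t ⟨ht0, ht⟩
      have h0 : 0 < 1 - 2 * t := by linarith
      set w := 2 * t / (1 - 2 * t) with hw
      have hwp : 0 < w := by positivity
      have hwm : (1 - 2 * t) * w = 2 * t := by rw [hw]; field_simp
      have := mul_le_mul_of_nonneg_left (quantile_mem hp0 hp1 w m).1 h0.le
      rw [abs_of_pos hwp, mul_sub, hwm] at this
      rw [limMag, if_pos ht, ← hw]; linarith
    · filter_upwards [hnear] with t ⟨ht0, ht⟩
      have h0 : 0 < 1 - 2 * t := by linarith
      set w := 2 * t / (1 - 2 * t) with hw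
      have hwm : (1 - 2 * t) * w = 2 * t := by rw [hw]; field_simp
      have hq := mixCdf_quantile hp0 hp1 w m
      have hle : quantile p w m + w ≤ b := by
        by_contra! hcon
        have h1 := strictMono_normalCdf hcon
        rw [div_lt_iff₀ hpq] at hb
        have h2 : 0 ≤ p * normalCdf (quantile p w m - w) := mul_nonneg hp0.le (cdf_nonneg _ _)
        have h3 := mul_lt_mul_of_pos_right h1 hpq
        rw [mixCdf] at hq
        linarith
      have := mul_le_mul_of_nonneg_left hle h0.le
      rw [mul_add, hwm] at this
      rw [limMag, if_pos ht, ← hw]; linarith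
  · rw [hhalf, if_pos hgt]
    have hr : 0 < (normalCdf m - (1 - p)) / p := div_pos (by linarith) hp0
    obtain ⟨b, hb⟩ := (tendsto_normalCdf_atBot.eventually (eventually_lt_nhds hr)).exists
    refine tendsto_of_tendsto_of_tendsto_of_le_of_le' (hlim 1 b) (hlim 1 m) ?_ ?_
    · filter_upwards [hnear] with t ⟨ht0, ht⟩
      have h0 : 0 < 1 - 2 * t := by linarith
      set w := 2 * t / (1 - 2 * t) with hw
      have hwm : (1 - 2 * t) * w = 2 * t := by rw [hw]; field_simp
      have hq := mixCdf_quantile hp0 hp1 w m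
      have hle : b ≤ quantile p w m - w := by
        by_contra! hcon
        have h1 := strictMono_normalCdf hcon
        rw [lt_div_iff₀ hp0] at hb
        have h2 : (1 - p) * normalCdf (quantile p w m + w) ≤ (1 - p) * 1 :=
          mul_le_mul_of_nonneg_left (cdf_le_one _ _) hpq.le
        have h3 := mul_lt_mul_of_pos_right h1 hp0
        rw [mixCdf] at hq
        linarith
      have := mul_le_mul_of_nonneg_left hle h0.le
      rw [mul_sub, hwm] at this
      rw [limMag, if_pos ht, ← hw]; linarith
    · filter_upwards [hnear] with t ⟨ht0, ht⟩
      have h0 : 0 < 1 - 2 * t := by linarith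
      set w := 2 * t / (1 - 2 * t) with hw
      have hwp : 0 < w := by positivity
      have hwm : (1 - 2 * t) * w = 2 * t := by rw [hw]; field_simp
      have := mul_le_mul_of_nonneg_left (quantile_mem hp0 hp1 w m).2 h0.le
      rw [abs_of_pos hwp, mul_add, hwm] at this
      rw [limMag, if_pos ht, ← hw]; linarith

lemma continuous_limMag {h : ℝ} (hp : p = Real.exp h / (Real.exp h + Real.exp (-h)))
    (hp0 : 0 < p) (hp1 : p < 1) {m : ℝ} (hm : normalCdf m ≠ 1 - p) : Continuous (limMag p m) := by
  rw [continuous_iff_continuousAt]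
  intro t
  rcases lt_trichotomy t (1 / 2) with ht | rfl | ht
  · exact (hasDerivAt_limMag hp hp0 hp1 m ht).continuousAt
  · rw [continuousAt_iff_continuous_left'_right']
    refine ⟨tendsto_limMag hp0 hp1 hm, ?_⟩
    refine (continuousWithinAt_const (b := limMag p m (1 / 2))).congr (fun s hs => ?_) rfl
    exact limMag_half (le_of_lt hs)
  · refine (continuousAt_const (y := limMag p m (1 / 2))).congr ?_
    filter_upwards [eventually_gt_nhds ht] with s hs
    exact (limMag_half hs.le).symm

lemma measurable_limMag (hp0 : 0 < p) (hp1 : p < 1) (t : ℝ) : Measurable fun m => limMag p m t := by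
  unfold limMag
  split_ifs
  · exact (strictMono_quantile hp0 hp1 _).monotone.measurable.const_mul _
  · exact Measurable.ite (measurableSet_lt measurable_const continuous_normalCdf.measurable)
      measurable_const measurable_const

lemma exists_separating (hp0 : 0 < p) (hp1 : p < 1) : ∃ m, normalCdf m = 1 - p :=
  mem_range_of_exists_le_of_exists_ge continuous_normalCdf
    ((tendsto_normalCdf_atBot.eventually (eventually_le_nhds (show 0 < 1 - p by linarith))).exists)
    ((tendsto_normalCdf_atTop.eventually (eventually_ge_nhds (show 1 - p < 1 by linarith))).exists)

/-- The terminal magnetization has the law of the sign in the mixture. -/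
lemma map_limMag_half (hp0 : 0 < p) (hp1 : p < 1) :
    (gaussianReal 0 1).map (fun m => limMag p m (1 / 2)) =
      ENNReal.ofReal p • Measure.dirac (1 : ℝ) + ENNReal.ofReal (1 - p) • Measure.dirac (-1 : ℝ) := by
  obtain ⟨m₀, hm₀⟩ := exists_separating hp0 hp1
  have hval : ∀ m, limMag p m (1 / 2) = if m₀ < m then 1 else -1 := by
    intro m
    simp only [limMag, lt_irrefl, if_false, ← hm₀, strictMono_normalCdf.lt_iff_lt]
  have hIic : gaussianReal 0 1 (Set.Iic m₀) = ENNReal.ofReal (1 - p) := by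
    rw [← hm₀, normalCdf, ofReal_cdf]
  have hIoi : gaussianReal 0 1 (Set.Ioi m₀) = ENNReal.ofReal p := by
    rw [← Set.compl_Iic, prob_compl_eq_one_sub measurableSet_Iic, hIic, ← ENNReal.ofReal_one,
      ← ENNReal.ofReal_sub _ (by linarith)]
    congr 1; ring
  ext S hS
  rw [Measure.map_apply (measurable_limMag hp0 hp1 _) hS]
  simp only [Measure.coe_add, Measure.coe_smul, Pi.add_apply, Pi.smul_apply, smul_eq_mul,
    Measure.dirac_apply' _ hS]
  have hpre : (fun m => limMag p m (1 / 2)) ⁻¹' S =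
      {m | m₀ < m ∧ (1 : ℝ) ∈ S} ∪ {m | m ≤ m₀ ∧ (-1 : ℝ) ∈ S} := by
    ext m
    simp only [Set.mem_preimage, hval, Set.mem_union, Set.mem_ofPred_eq]
    by_cases h : m₀ < m
    · simp [h, not_le.2 h]
    · simp [h, not_lt.1 h]
  rw [hpre]
  by_cases h1 : (1 : ℝ) ∈ S <;> by_cases h2 : (-1 : ℝ) ∈ S
  · have : {m | m₀ < m ∧ (1 : ℝ) ∈ S} ∪ {m | m ≤ m₀ ∧ (-1 : ℝ) ∈ S} = Set.univ := by
      ext m; simp [h1, h2, lt_or_ge]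
    rw [this]
    simp [h1, h2, ← ENNReal.ofReal_add hp0.le (sub_nonneg.2 hp1.le)]
  · have : {m | m₀ < m ∧ (1 : ℝ) ∈ S} ∪ {m | m ≤ m₀ ∧ (-1 : ℝ) ∈ S} = Set.Ioi m₀ := by
      ext m; simp [h1, h2]
    rw [this, hIoi]
    simp [h1, h2]
  · have : {m | m₀ < m ∧ (1 : ℝ) ∈ S} ∪ {m | m ≤ m₀ ∧ (-1 : ℝ) ∈ S} = Set.Iic m₀ := by
      ext m; simp [h1, h2]
    rw [this, hIic]
    simp [h1, h2]
  · have : {m | m₀ < m ∧ (1 : ℝ) ∈ S} ∪ {m | m ≤ m₀ ∧ (-1 : ℝ) ∈ S} = ∅ := by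
      ext m; simp [h1, h2]
    rw [this]
    simp [h1, h2]

end

/-! ### Grid points -/

lemma grid_cast (N k : ℕ) : (k : ℝ) * (1 / (2 * (N : ℝ))) = k / (2 * N) := by
  ring

lemma floor_grid {N : ℕ} (hN : 1 ≤ N) (k : ℕ) :
    ⌊((k : ℝ) / (2 * N)) / (1 / (2 * (N : ℝ)))⌋₊ = k := by
  have : ((k : ℝ) / (2 * N)) / (1 / (2 * (N : ℝ))) = k := by
    have : (N : ℝ) ≠ 0 := by positivity
    field_simp
  rw [this, Nat.floor_natCast]

lemma eulerR_grid {N : ℕ} (hN : 1 ≤ N) (g : ℝ → ℝ → ℝ) (x : ℝ) (k : ℕ) :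
    eulerR g (1 / (2 * (N : ℝ))) x (k / (2 * N)) = iterR g (1 / (2 * (N : ℝ))) x k := by
  rw [eulerR, floor_grid hN, grid_cast]
  simp

lemma eulerR_half {N : ℕ} (hN : 1 ≤ N) (g : ℝ → ℝ → ℝ) (x : ℝ) :
    eulerR g (1 / (2 * (N : ℝ))) x (1 / 2) = iterR g (1 / (2 * (N : ℝ))) x N := by
  rw [← eulerR_grid hN]
  congr 1
  have : (N : ℝ) ≠ 0 := by positivity
  field_simp

lemma floor_le_mul {N : ℕ} (hN : 1 ≤ N) {t : ℝ} (ht : 0 ≤ t) :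
    (⌊t / (1 / (2 * (N : ℝ)))⌋₊ : ℝ) * (1 / (2 * (N : ℝ))) ≤ t := by
  have hδ : (0 : ℝ) < 1 / (2 * (N : ℝ)) := by positivity
  rw [← le_div_iff₀ hδ]
  exact Nat.floor_le (by positivity)

lemma lt_floor_mul {N : ℕ} (hN : 1 ≤ N) (t : ℝ) :
    t < ((⌊t / (1 / (2 * (N : ℝ)))⌋₊ : ℝ) + 1) * (1 / (2 * (N : ℝ))) := by
  have hδ : (0 : ℝ) < 1 / (2 * (N : ℝ)) := by positivity
  rw [← div_lt_iff₀ hδ]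
  exact Nat.lt_floor_add_one _

lemma le_floor_of_half_le {N : ℕ} (hN : 1 ≤ N) {t : ℝ} (ht : 1 / 2 ≤ t) :
    N ≤ ⌊t / (1 / (2 * (N : ℝ)))⌋₊ := by
  have hN' : (0 : ℝ) < N := by positivity
  apply Nat.le_floor
  rw [le_div_iff₀ (by positivity), mul_one_div, div_le_iff₀ (by positivity)]
  nlinarith

lemma floor_le_of_le_one {N : ℕ} (hN : 1 ≤ N) {t : ℝ} (ht : t ≤ 1) :
    ⌊t / (1 / (2 * (N : ℝ)))⌋₊ ≤ 2 * N := by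
  have hN' : (0 : ℝ) < N := by positivity
  apply Nat.floor_le_of_le
  rw [div_le_iff₀ (by positivity)]
  push_cast
  rwa [mul_one_div_cancel (by positivity)]

/-! ### The first phase in the limit of infinite dimension -/

/-- In the first phase, each Euler step on the uniform grid is a convex combination of the current
magnetization and of a hyperbolic tangent. -/
lemma iterR_limField_succ (h κ σ : ℝ) {N : ℕ} {k : ℕ} (hk : k < N) (m : ℝ) :
    iterR (limField h κ σ) (1 / (2 * (N : ℝ))) m (k + 1) =
      (1 - 1 / ((N : ℝ) - k)) * iterR (limField h κ σ) (1 / (2 * (N : ℝ))) m k +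
        1 / ((N : ℝ) - k) * Real.tanh (h + k * N / ((N : ℝ) - k) ^ 2 *
          iterR (limField h κ σ) (1 / (2 * (N : ℝ))) m k) := by
  have hkN : (k : ℝ) < N := by exact_mod_cast hk
  have hN0 : (0 : ℝ) < N := by have : (0 : ℝ) ≤ k := by positivity
                               linarith
  have hd : (N : ℝ) - k ≠ 0 := by linarith
  have ht : (k : ℝ) * (1 / (2 * (N : ℝ))) < 1 / 2 := by
    rw [mul_one_div, div_lt_iff₀ (by positivity)]; linarith
  rw [iterR, limField, if_pos ht]
  set y := iterR (limField h κ σ) (1 / (2 * (N : ℝ))) m k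
  have e1 : 2 * ((k : ℝ) * (1 / (2 * (N : ℝ)))) * y / (1 - 2 * ((k : ℝ) * (1 / (2 * (N : ℝ))))) ^ 2 =
      k * N / ((N : ℝ) - k) ^ 2 * y := by
    have : 1 - 2 * ((k : ℝ) * (1 / (2 * (N : ℝ)))) = (N - k) / N := by field_simp
    rw [this]
    field_simp
  have e2 : 1 / 2 - (k : ℝ) * (1 / (2 * (N : ℝ))) = (N - k) / (2 * N) := by field_simp
  rw [e1, e2]
  field_simp
  ring

lemma limField_lipschitz (h κ σ : ℝ) {T : ℝ} (hT : T < 1 / 2) {t : ℝ} (ht : t ∈ Set.Icc 0 T)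
    (u v : ℝ) : |limField h κ σ t u - limField h κ σ t v| ≤
      (1 + 2 * T / (1 - 2 * T) ^ 2) / (1 / 2 - T) * |u - v| := by
  have htT := ht.2
  have ht0 := ht.1
  have hT0 : 0 ≤ T := ht0.trans htT
  have ht' : t < 1 / 2 := by linarith
  have h1 : 0 < 1 / 2 - T := by linarith
  have h2 : 0 < 1 / 2 - t := by linarith
  have h3 : 0 < 1 - 2 * T := by linarith
  have h4 : 0 < 1 - 2 * t := by linarith
  rw [limField, limField, if_pos ht', if_pos ht', ← sub_div, abs_div, abs_of_pos h2, div_mul_eq_mul_div]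
  have hgain : 2 * t / (1 - 2 * t) ^ 2 ≤ 2 * T / (1 - 2 * T) ^ 2 := by gcongr
  have h5 := abs_tanh_sub_le (h + 2 * t * u / (1 - 2 * t) ^ 2) (h + 2 * t * v / (1 - 2 * t) ^ 2)
  have e : h + 2 * t * u / (1 - 2 * t) ^ 2 - (h + 2 * t * v / (1 - 2 * t) ^ 2) =
      2 * t / (1 - 2 * t) ^ 2 * (u - v) := by ring
  rw [e, abs_mul, abs_of_nonneg (show 0 ≤ 2 * t / (1 - 2 * t) ^ 2 by positivity)] at h5
  have h6 := mul_le_mul_of_nonneg_right hgain (abs_nonneg (u - v))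
  have hnum : |-u + Real.tanh (h + 2 * t * u / (1 - 2 * t) ^ 2) -
      (-v + Real.tanh (h + 2 * t * v / (1 - 2 * t) ^ 2))| ≤
      (1 + 2 * T / (1 - 2 * T) ^ 2) * |u - v| := by
    have e2 : -u + Real.tanh (h + 2 * t * u / (1 - 2 * t) ^ 2) -
      (-v + Real.tanh (h + 2 * t * v / (1 - 2 * t) ^ 2)) =
      (Real.tanh (h + 2 * t * u / (1 - 2 * t) ^ 2) - Real.tanh (h + 2 * t * v / (1 - 2 * t) ^ 2)) -
        (u - v) := by ring
    rw [e2]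
    refine (abs_sub _ _).trans ?_
    linarith
  gcongr

/-- Euler approximation of the limiting magnetization on `[0, T]`, uniformly over the grid. -/
lemma euler_limMag {p h : ℝ} (hp : p = Real.exp h / (Real.exp h + Real.exp (-h)))
    (hp0 : 0 < p) (hp1 : p < 1) (κ σ m : ℝ) {T : ℝ} (hT0 : 0 ≤ T) (hT : T < 1 / 2) {ε : ℝ}
    (hε : 0 < ε) : ∀ᶠ N : ℕ in atTop, ∀ t ∈ Set.Icc 0 T, ∀ k : ℕ,
      k * (1 / (2 * (N : ℝ))) ≤ t → t ≤ (k + 1) * (1 / (2 * (N : ℝ))) →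
      |iterR (limField h κ σ) (1 / (2 * (N : ℝ))) m k + (t - k * (1 / (2 * (N : ℝ)))) *
        limField h κ σ (k * (1 / (2 * (N : ℝ))))
          (iterR (limField h κ σ) (1 / (2 * (N : ℝ))) m k) - limMag p m t| ≤ ε := by
  have h1 : 0 < 1 / 2 - T := by linarith
  have hK : 0 ≤ (1 + 2 * T / (1 - 2 * T) ^ 2) / (1 / 2 - T) := by positivity
  have hval : ∀ t, t < 1 / 2 → limField h κ σ t (limMag p m t) =
      (-(limMag p m t) + Real.tanh (h + 2 * t * limMag p m t / (1 - 2 * t) ^ 2)) / (1 / 2 - t) :=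
    fun t ht => if_pos ht
  have hy : ∀ t ∈ Set.Icc 0 T,
      HasDerivWithinAt (limMag p m) (limField h κ σ t (limMag p m t)) (Set.Icc 0 T) t := by
    intro t ht
    have ht' : t < 1 / 2 := ht.2.trans_lt hT
    rw [hval t ht']
    exact (hasDerivAt_limMag hp hp0 hp1 m ht').hasDerivWithinAt
  have hc : ContinuousOn (fun t => limField h κ σ t (limMag p m t)) (Set.Icc 0 T) := by
    have hM : ContinuousOn (limMag p m) (Set.Icc 0 T) := fun t ht => (hy t ht).continuousWithinAt
    have hco : ContinuousOn (fun t => (-(limMag p m t) +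
        Real.tanh (h + 2 * t * limMag p m t / (1 - 2 * t) ^ 2)) / (1 / 2 - t)) (Set.Icc 0 T) := by
      refine ContinuousOn.div (hM.neg.add (continuous_tanh.comp_continuousOn
        (continuousOn_const.add (ContinuousOn.div (by fun_prop) (by fun_prop) ?_)))) (by fun_prop) ?_
      · intro t ht
        have := ht.2
        exact pow_ne_zero 2 (by linarith)
      · intro t ht
        have := ht.2
        linarith
    exact hco.congr fun t ht => hval t (ht.2.trans_lt hT)
  obtain ⟨η, hη, H⟩ := euler_converges hK hT0
    (fun t ht u v => limField_lipschitz h κ σ hT ht u v) hy hc hε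
  have hlim : Tendsto (fun N : ℕ => 1 / (2 * (N : ℝ))) atTop (𝓝 0) :=
    tendsto_const_nhds.div_atTop (tendsto_natCast_atTop_atTop.const_mul_atTop two_pos)
  filter_upwards [hlim.eventually (eventually_lt_nhds hη), eventually_ge_atTop 1] with N hN hN1
  intro t ht k hk1 hk2
  exact H _ (by positivity) hN (iterR (limField h κ σ) (1 / (2 * (N : ℝ))) m) 0 (by simp)
    (limMag_zero hp0 hp1 m).symm (fun k _ => rfl) t ht k (Nat.zero_le _) hk1 hk2

lemma tendsto_euler_first {p h : ℝ} (hp : p = Real.exp h / (Real.exp h + Real.exp (-h)))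
    (hp0 : 0 < p) (hp1 : p < 1) (κ σ m : ℝ) {t : ℝ} (ht0 : 0 ≤ t) (ht : t < 1 / 2) :
    Tendsto (fun N : ℕ => eulerR (limField h κ σ) (1 / (2 * (N : ℝ))) m t) atTop
      (𝓝 (limMag p m t)) := by
  rw [Metric.tendsto_nhds]
  intro ε hε
  filter_upwards [euler_limMag hp hp0 hp1 κ σ m ht0 ht (half_pos hε), eventually_ge_atTop 1]
    with N hN hN1
  rw [Real.dist_eq]
  exact (hN t ⟨ht0, le_rfl⟩ _ (floor_le_mul hN1 ht0) (lt_floor_mul hN1 t).le).trans_lt (by linarith)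

lemma sign_mul_tanh {s : ℝ} (hs : s = 1 ∨ s = -1) (x : ℝ) : s * Real.tanh x = Real.tanh (s * x) := by
  rcases hs with rfl | rfl <;> simp

/-- At the end of the first phase the Euler scheme reaches the selected sign `s`. Close to time
`1/2` the region `s M ≥ 1/2` is invariant, and the last step equals
`tanh (h + N (N - 1) M)`. -/
lemma tendsto_iter_half {p h : ℝ} (hp : p = Real.exp h / (Real.exp h + Real.exp (-h)))
    (hp0 : 0 < p) (hp1 : p < 1) (κ σ : ℝ) {m : ℝ} (hm : normalCdf m ≠ 1 - p) :
    Tendsto (fun N : ℕ => iterR (limField h κ σ) (1 / (2 * (N : ℝ))) m N) atTop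
      (𝓝 (limMag p m (1 / 2))) := by
  set s := limMag p m (1 / 2) with hsdef
  have hs : s = 1 ∨ s = -1 := by
    rw [hsdef]; simp only [limMag, lt_irrefl, if_false]; split_ifs <;> simp
  have hss : s * s = 1 := by rcases hs with h | h <;> rw [h] <;> norm_num
  -- past some time `l`, the limiting magnetization and the hyperbolic tangent are close to `s`
  have hev : ∀ᶠ t : ℝ in 𝓝[<] (1 / 2), 3 / 4 < s * limMag p m t ∧
      1 / 2 < Real.tanh (s * h + 2 * t / (1 - 2 * t) ^ 2 * (1 / 2)) := by
    have h1 : Tendsto (fun t => s * limMag p m t) (𝓝[<] (1 / 2)) (𝓝 1) := by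
      have := (tendsto_limMag hp0 hp1 hm).const_mul s
      rwa [← hsdef, hss] at this
    have h2 : Tendsto (fun t : ℝ => 2 * t / (1 - 2 * t) ^ 2) (𝓝[<] (1 / 2)) atTop := by
      have hn : Tendsto (fun t : ℝ => 2 * t) (𝓝[<] (1 / 2)) (𝓝 1) := by
        have : Continuous fun t : ℝ => 2 * t := by fun_prop
        simpa using (this.tendsto (1 / 2)).mono_left nhdsWithin_le_nhds
      have hd : Tendsto (fun t : ℝ => (1 - 2 * t) ^ 2) (𝓝[<] (1 / 2)) (𝓝[>] 0) := by
        refine tendsto_nhdsWithin_iff.2 ⟨?_, ?_⟩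
        · have : Continuous fun t : ℝ => (1 - 2 * t) ^ 2 := by fun_prop
          simpa using (this.tendsto (1 / 2)).mono_left nhdsWithin_le_nhds
        · filter_upwards [self_mem_nhdsWithin] with t ht
          have ht' : t < 1 / 2 := ht
          have : 0 < 1 - 2 * t := by linarith
          exact Set.mem_Ioi.2 (by positivity)
      exact hn.pos_mul_atTop one_pos hd.inv_tendsto_nhdsGT_zero
    have h3 := tendsto_tanh_atTop.comp (tendsto_atTop_add_const_left _ (s * h)
      (h2.atTop_mul_const (show (0 : ℝ) < 1 / 2 by norm_num)))
    exact (h1.eventually (eventually_gt_nhds (by norm_num))).and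
      (h3.eventually (eventually_gt_nhds (by norm_num)))
  obtain ⟨l, hl, hlsub⟩ := (mem_nhdsLT_iff_exists_Ioo_subset' (show (0 : ℝ) < 1 / 2 by norm_num)).1 hev
  have hl' : l < 1 / 2 := hl
  obtain ⟨t₀, ht₀, ht₀'⟩ := exists_between (max_lt hl' (show (0 : ℝ) < 1 / 2 by norm_num))
  obtain ⟨T, hT₀, hT⟩ := exists_between ht₀'
  have ht₀l : l < t₀ := (le_max_left _ _).trans_lt ht₀
  have ht₀0 : 0 < t₀ := (le_max_right _ _).trans_lt ht₀
  have hlim : Tendsto (fun N : ℕ => 1 / (2 * (N : ℝ))) atTop (𝓝 0) :=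
    tendsto_const_nhds.div_atTop (tendsto_natCast_atTop_atTop.const_mul_atTop two_pos)
  have hlast : ∀ᶠ N : ℕ in atTop, 1 / 2 ≤
      s * iterR (limField h κ σ) (1 / (2 * (N : ℝ))) m (N - 1) := by
    filter_upwards [euler_limMag hp hp0 hp1 κ σ m (ht₀0.le.trans hT₀.le) hT
      (show (0 : ℝ) < 1 / 4 by norm_num), eventually_ge_atTop 1,
      hlim.eventually (eventually_lt_nhds (sub_pos.2 hT₀)),
      hlim.eventually (eventually_lt_nhds (sub_pos.2 hT))] with N hN hN1 hδ hδ2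
    set e := iterR (limField h κ σ) (1 / (2 * (N : ℝ))) m with he
    have hN0 : (0 : ℝ) < N := by positivity
    -- the first grid point after `t₀`
    obtain ⟨k, hk⟩ : ∃ k : ℕ, k = ⌊t₀ / (1 / (2 * (N : ℝ)))⌋₊ + 1 := ⟨_, rfl⟩
    have hk1 : t₀ < k * (1 / (2 * (N : ℝ))) := by
      have := lt_floor_mul hN1 t₀
      rw [hk]; exact_mod_cast this
    have hk2 : k * (1 / (2 * (N : ℝ))) ≤ T := by
      have := floor_le_mul hN1 ht₀0.le
      rw [hk]; push_cast; linarith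
    have hbase : 1 / 2 ≤ s * e k := by
      have h1 := hN _ ⟨ht₀0.le.trans hk1.le, hk2⟩ k le_rfl
        (by rw [add_mul, one_mul]; linarith [show (0 : ℝ) < 1 / (2 * (N : ℝ)) by positivity])
      rw [sub_self, zero_mul, add_zero] at h1
      have h2 := (hlsub ⟨ht₀l.trans hk1, hk2.trans_lt hT⟩).1
      have h3 : |s * e k - s * limMag p m (k * (1 / (2 * (N : ℝ))))| ≤ 1 / 4 := by
        rw [← mul_sub, abs_mul]
        have : |s| = 1 := by rcases hs with h | h <;> rw [h] <;> norm_num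
        rw [this, one_mul]; exact h1
      have := (abs_le.1 h3).1
      linarith
    have hinv : ∀ j ≥ k, j ≤ N - 1 → 1 / 2 ≤ s * e j := by
      intro j hj
      induction j, hj using Nat.le_induction with
      | base => exact fun _ => hbase
      | succ j hj ih =>
        intro hjN
        have ih' := ih (by omega)
        have hjlt : j < N := by omega
        have hjN' : (j : ℝ) + 1 ≤ N := by exact_mod_cast hjlt
        have ha : 0 < (N : ℝ) - j := by linarith
        have ha1 : 1 / ((N : ℝ) - j) ≤ 1 := (div_le_one ha).2 (by linarith)
        have ha0 : 0 ≤ 1 / ((N : ℝ) - j) := by positivity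
        have hrec := iterR_limField_succ h κ σ hjlt m
        rw [← he] at hrec
        have hjt : t₀ < j * (1 / (2 * (N : ℝ))) := hk1.trans_le (by gcongr)
        have hjt2 : j * (1 / (2 * (N : ℝ))) < 1 / 2 := by
          rw [mul_one_div, div_lt_iff₀ (by positivity)]; linarith
        have h2 := (hlsub ⟨ht₀l.trans hjt, hjt2⟩).2
        have e1 : 2 * ((j : ℝ) * (1 / (2 * (N : ℝ)))) / (1 - 2 * ((j : ℝ) * (1 / (2 * (N : ℝ))))) ^ 2 =
            j * N / ((N : ℝ) - j) ^ 2 := by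
          have : 1 - 2 * ((j : ℝ) * (1 / (2 * (N : ℝ)))) = (N - j) / N := by field_simp
          rw [this]
          field_simp
        rw [e1] at h2
        have h3 : 1 / 2 ≤ s * Real.tanh (h + j * N / ((N : ℝ) - j) ^ 2 * e j) := by
          rw [sign_mul_tanh hs]
          refine h2.le.trans (strictMono_tanh.monotone ?_)
          have : s * (h + j * N / ((N : ℝ) - j) ^ 2 * e j) =
            s * h + j * N / ((N : ℝ) - j) ^ 2 * (s * e j) := by ring
          rw [this]
          gcongr
        have e2 : s * e (j + 1) = (1 - 1 / ((N : ℝ) - j)) * (s * e j) + 1 / ((N : ℝ) - j) *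
            (s * Real.tanh (h + j * N / ((N : ℝ) - j) ^ 2 * e j)) := by
          rw [hrec]; ring
        rw [e2]
        have h4 := mul_le_mul_of_nonneg_left ih' (sub_nonneg.2 ha1)
        have h5 := mul_le_mul_of_nonneg_left h3 ha0
        linarith
    refine hinv (N - 1) ?_ le_rfl
    have : (k : ℝ) < N := by
      have h1 : k * (1 / (2 * (N : ℝ))) < 1 / 2 := hk2.trans_lt hT
      rw [mul_one_div, div_lt_iff₀ (by positivity)] at h1
      linarith
    have : k < N := by exact_mod_cast this
    omega
  have hsN : Tendsto (fun N : ℕ => s * iterR (limField h κ σ) (1 / (2 * (N : ℝ))) m N) atTop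
      (𝓝 1) := by
    have hbig : Tendsto (fun N : ℕ => Real.tanh (s * h + ((N : ℝ) - 1) * (1 / 2))) atTop (𝓝 1) := by
      refine tendsto_tanh_atTop.comp (tendsto_atTop_add_const_left _ _ ?_)
      exact (tendsto_atTop_add_const_right _ (-1) tendsto_natCast_atTop_atTop).atTop_mul_const
        (by norm_num)
    have hform : ∀ᶠ N : ℕ in atTop, s * iterR (limField h κ σ) (1 / (2 * (N : ℝ))) m N =
        Real.tanh (s * h + ((N : ℝ) - 1) * N *
          (s * iterR (limField h κ σ) (1 / (2 * (N : ℝ))) m (N - 1))) := by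
      filter_upwards [eventually_ge_atTop 1] with N hN1
      obtain ⟨n, rfl⟩ : ∃ n, N = n + 1 := ⟨N - 1, by omega⟩
      rw [iterR_limField_succ h κ σ (Nat.lt_succ_self n) m, Nat.add_sub_cancel]
      have : ((n + 1 : ℕ) : ℝ) - n = 1 := by push_cast; ring
      rw [this]
      simp only [div_one, sub_self, zero_mul, zero_add, one_mul, one_pow]
      rw [sign_mul_tanh hs]
      congr 1
      push_cast
      ring
    refine tendsto_of_tendsto_of_tendsto_of_le_of_le' hbig tendsto_const_nhds ?_ ?_
    · filter_upwards [hform, hlast, eventually_ge_atTop 1] with N hN hl hN1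
      rw [hN]
      refine strictMono_tanh.monotone ?_
      have hN1' : (1 : ℝ) ≤ N := by exact_mod_cast hN1
      have h1 : ((N : ℝ) - 1) * (1 / 2) ≤ (N - 1) * N * (1 / 2) := by nlinarith
      have h2 := mul_le_mul_of_nonneg_left hl
        (mul_nonneg (sub_nonneg.2 hN1') (by positivity : (0 : ℝ) ≤ N))
      linarith
    · filter_upwards [hform] with N hN
      rw [hN]
      exact (Real.tanh_lt_one _).le
  have := hsN.const_mul s
  rw [mul_one] at this
  refine this.congr fun N => ?_
  rw [← mul_assoc, hss, one_mul]

/-! ### The second phase in the limit of infinite dimension -/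

lemma rate_le {κ σ : ℝ} (hσ : 0 < σ) {t : ℝ} (ht : 1 / 2 ≤ t) :
    rate κ σ t ≤ 2 * κ ^ 2 / σ ^ 2 := by
  unfold rate
  have h1 : 2 - 2 * t ≤ 1 := by linarith
  have h2 : 2 * κ ^ 2 * (2 - 2 * t) ≤ 2 * κ ^ 2 :=
    mul_le_of_le_one_right (by positivity) h1
  have h3 : σ ^ 2 ≤ κ ^ 2 * (2 - 2 * t) ^ 2 + σ ^ 2 := by nlinarith [sq_nonneg (κ * (2 - 2 * t))]
  have h4 : 0 < σ ^ 2 := by positivity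
  exact div_le_div₀ (by positivity) h2 h4 h3

/-- A relaxation step towards the sign keeps the sign and does not increase the distance to it. -/
lemma relax_step {a y : ℝ} (ha0 : 0 ≤ a) (ha1 : a ≤ 1) (hy : y ≠ 0) :
    y + a * (sgn y - y) ≠ 0 ∧ sgn (y + a * (sgn y - y)) = sgn y ∧
      |y + a * (sgn y - y) - sgn y| ≤ |y - sgn y| := by
  refine ⟨?_, ?_, ?_⟩
  · rcases lt_or_gt_of_ne hy with h | h
    · rw [sgn, if_neg (not_lt.2 h.le)]
      apply ne_of_lt
      rcases eq_or_lt_of_le ha0 with h0 | h0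
      · rw [← h0]; simpa using h
      · nlinarith
    · rw [sgn, if_pos h]
      apply ne_of_gt
      rcases eq_or_lt_of_le ha0 with h0 | h0
      · rw [← h0]; simpa using h
      · nlinarith
  · rcases lt_or_gt_of_ne hy with h | h
    · have : sgn y = -1 := if_neg (not_lt.2 h.le)
      rw [this]
      refine if_neg (not_lt.2 ?_)
      nlinarith
    · have : sgn y = 1 := if_pos h
      rw [this]
      refine if_pos ?_
      rcases eq_or_lt_of_le ha0 with h0 | h0
      · rw [← h0]; simpa using h
      · nlinarith
  · have : y + a * (sgn y - y) - sgn y = (1 - a) * (y - sgn y) := by ring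
    rw [this, abs_mul, abs_of_nonneg (sub_nonneg.2 ha1)]
    exact mul_le_of_le_one_left (abs_nonneg _) (by linarith)

lemma half_le_grid {N k : ℕ} (hN : 1 ≤ N) (hk : N ≤ k) : 1 / 2 ≤ (k : ℝ) * (1 / (2 * (N : ℝ))) := by
  have hk' : (N : ℝ) ≤ k := by exact_mod_cast hk
  have hN' : (0 : ℝ) < N := by positivity
  rw [mul_one_div, le_div_iff₀ (by positivity)]; linarith

lemma grid_le_one {N k : ℕ} (hN : 1 ≤ N) (hk : k ≤ 2 * N) : (k : ℝ) * (1 / (2 * (N : ℝ))) ≤ 1 := by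
  have hk' : (k : ℝ) ≤ 2 * N := by exact_mod_cast hk
  have hN' : (0 : ℝ) < N := by positivity
  rw [mul_one_div, div_le_iff₀ (by positivity)]; linarith

lemma limField_second {h κ σ t : ℝ} (ht : 1 / 2 ≤ t) (y : ℝ) :
    limField h κ σ t y = rate κ σ t * (sgn y - y) := if_neg (not_lt.2 ht)

/-- A second-phase time step is short enough for `relax_step`. -/
lemma step_mul_rate {κ σ : ℝ} (hσ : 0 < σ) {N : ℕ} (hN : 1 ≤ N) (hR : κ ^ 2 / σ ^ 2 ≤ N)
    {t ρ : ℝ} (ht : 1 / 2 ≤ t) (ht1 : t ≤ 1) (hρ0 : 0 ≤ ρ) (hρ : ρ ≤ 1 / (2 * (N : ℝ))) :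
    0 ≤ ρ * rate κ σ t ∧ ρ * rate κ σ t ≤ 1 := by
  have hN' : (0 : ℝ) < N := by positivity
  have h1 := rate_le (κ := κ) hσ ht
  have h0 : 0 ≤ rate κ σ t := rate_nonneg ht1
  refine ⟨mul_nonneg hρ0 h0, ?_⟩
  calc ρ * rate κ σ t ≤ 1 / (2 * (N : ℝ)) * (2 * N) := by
        refine mul_le_mul hρ (h1.trans ?_) h0 (by positivity)
        rw [mul_div_assoc]; linarith
    _ = 1 := by field_simp

lemma iter_second {h κ σ : ℝ} (hσ : 0 < σ) {N : ℕ} (hN : 1 ≤ N) (hR : κ ^ 2 / σ ^ 2 ≤ N) {m : ℝ}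
    (hm : iterR (limField h κ σ) (1 / (2 * (N : ℝ))) m N ≠ 0) {k : ℕ} (hk : N ≤ k)
    (hk2 : k ≤ 2 * N) :
    iterR (limField h κ σ) (1 / (2 * (N : ℝ))) m k ≠ 0 ∧
      sgn (iterR (limField h κ σ) (1 / (2 * (N : ℝ))) m k) =
        sgn (iterR (limField h κ σ) (1 / (2 * (N : ℝ))) m N) ∧
      |iterR (limField h κ σ) (1 / (2 * (N : ℝ))) m k -
          sgn (iterR (limField h κ σ) (1 / (2 * (N : ℝ))) m N)| ≤
        |iterR (limField h κ σ) (1 / (2 * (N : ℝ))) m N -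
          sgn (iterR (limField h κ σ) (1 / (2 * (N : ℝ))) m N)| := by
  induction k, hk using Nat.le_induction with
  | base => exact ⟨hm, rfl, le_rfl⟩
  | succ k hk ih =>
    obtain ⟨ih1, ih2, ih3⟩ := ih (by omega)
    have hr := step_mul_rate (κ := κ) hσ hN hR (half_le_grid hN hk)
      (grid_le_one hN (show k ≤ 2 * N by omega))
      (show (0 : ℝ) ≤ 1 / (2 * (N : ℝ)) by positivity) le_rfl
    rw [iterR, limField_second (half_le_grid hN hk), ← mul_assoc]
    obtain ⟨a, b, c⟩ := relax_step hr.1 hr.2 ih1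
    rw [ih2] at a b c ⊢
    exact ⟨a, b, c.trans ih3⟩

lemma sgn_of_close {s y : ℝ} (hs : s = 1 ∨ s = -1) (hy : |y - s| < 1) : y ≠ 0 ∧ sgn y = s := by
  rw [abs_lt] at hy
  rcases hs with rfl | rfl
  · have : 0 < y := by linarith
    exact ⟨this.ne', if_pos this⟩
  · have : y < 0 := by linarith
    exact ⟨this.ne, if_neg (not_lt.2 this.le)⟩

lemma tendsto_euler_second {p h : ℝ} (hp : p = Real.exp h / (Real.exp h + Real.exp (-h)))
    (hp0 : 0 < p) (hp1 : p < 1) (κ : ℝ) {σ : ℝ} (hσ : 0 < σ) {m : ℝ} (hm : normalCdf m ≠ 1 - p)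
    {t : ℝ} (ht : 1 / 2 ≤ t) (ht1 : t ≤ 1) :
    Tendsto (fun N : ℕ => eulerR (limField h κ σ) (1 / (2 * (N : ℝ))) m t) atTop
      (𝓝 (limMag p m t)) := by
  have hhalf := tendsto_iter_half hp hp0 hp1 κ σ hm
  rw [limMag_half ht]
  have hs : limMag p m (1 / 2) = 1 ∨ limMag p m (1 / 2) = -1 := by
    simp only [limMag, lt_irrefl, if_false]; split_ifs <;> simp
  set s := limMag p m (1 / 2)
  have hz := (hhalf.sub_const s).abs
  rw [sub_self, abs_zero] at hz
  rw [tendsto_iff_norm_sub_tendsto_zero]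
  refine squeeze_zero' (Eventually.of_forall fun N => norm_nonneg _) ?_ hz
  filter_upwards [hz.eventually (eventually_lt_nhds one_pos), eventually_ge_atTop 1,
    tendsto_natCast_atTop_atTop.eventually_ge_atTop (κ ^ 2 / σ ^ 2)] with N hN hN1 hR
  obtain ⟨h0, hsg⟩ := sgn_of_close hs hN
  have hk := le_floor_of_half_le hN1 ht
  have hk2 := floor_le_of_le_one hN1 ht1
  obtain ⟨a, b, c⟩ := iter_second hσ hN1 hR h0 hk hk2
  rw [hsg] at b c
  rw [Real.norm_eq_abs, eulerR, limField_second (half_le_grid hN1 hk), ← mul_assoc]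
  have hle := floor_le_mul hN1 (show 0 ≤ t by linarith)
  have hlt := lt_floor_mul hN1 t
  rw [add_mul, one_mul] at hlt
  have hr := step_mul_rate (κ := κ) hσ hN1 hR (half_le_grid hN1 hk) (grid_le_one hN1 hk2)
    (sub_nonneg.2 hle) (by linarith)
  have := (relax_step hr.1 hr.2 a).2.2
  rw [b] at this ⊢
  exact this.trans c

lemma tendsto_euler_limMag {p h : ℝ} (hp : p = Real.exp h / (Real.exp h + Real.exp (-h)))
    (hp0 : 0 < p) (hp1 : p < 1) (κ : ℝ) {σ : ℝ} (hσ : 0 < σ) {m : ℝ} (hm : normalCdf m ≠ 1 - p)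
    {t : ℝ} (ht : t ∈ Set.Icc (0 : ℝ) 1) :
    Tendsto (fun N : ℕ => eulerR (limField h κ σ) (1 / (2 * (N : ℝ))) m t) atTop
      (𝓝 (limMag p m t)) := by
  rcases lt_or_ge t (1 / 2) with h1 | h1
  · exact tendsto_euler_first hp hp0 hp1 κ σ m ht.1 h1
  · exact tendsto_euler_second hp hp0 hp1 κ hσ hm h1 ht.2

/-! ### The limit of infinite dimension for a fixed step size -/

lemma tendsto_iter_dim (h κ : ℝ) {σ : ℝ} (hσ : 0 < σ) {N : ℕ} (hN : 1 ≤ N)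
    (hR : κ ^ 2 / σ ^ 2 ≤ N) {m : ℝ}
    (hm : iterR (limField h κ σ) (1 / (2 * (N : ℝ))) m N ≠ 0) {y : ℕ → ℝ}
    (hy : Tendsto y atTop (𝓝 m)) {k : ℕ} (hk : k ≤ 2 * N) :
    Tendsto (fun d => iterR (magField h κ σ d) (1 / (2 * (N : ℝ))) (y d) k) atTop
      (𝓝 (iterR (limField h κ σ) (1 / (2 * (N : ℝ))) m k)) := by
  induction k with
  | zero => exact hy
  | succ k ih =>
    have ih' := ih (by omega)
    refine ih'.add ((tendsto_magField h κ hσ ih' fun ht => ?_).const_mul _)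
    have hNk : N ≤ k := by
      by_contra! hcon
      have hcon' : (k : ℝ) < N := by exact_mod_cast hcon
      have hN' : (0 : ℝ) < N := by positivity
      rw [mul_one_div, le_div_iff₀ (by positivity)] at ht
      linarith
    exact (iter_second hσ hN hR hm hNk (by omega)).1

lemma tendsto_euler_dim (h κ : ℝ) {σ : ℝ} (hσ : 0 < σ) {N : ℕ} (hN : 1 ≤ N)
    (hR : κ ^ 2 / σ ^ 2 ≤ N) {m : ℝ}
    (hm : iterR (limField h κ σ) (1 / (2 * (N : ℝ))) m N ≠ 0) {y : ℕ → ℝ}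
    (hy : Tendsto y atTop (𝓝 m)) {t : ℝ} (ht : t ∈ Set.Icc (0 : ℝ) 1) :
    Tendsto (fun d => eulerR (magField h κ σ d) (1 / (2 * (N : ℝ))) (y d) t) atTop
      (𝓝 (eulerR (limField h κ σ) (1 / (2 * (N : ℝ))) m t)) := by
  have hk2 := floor_le_of_le_one hN ht.2
  have hit := tendsto_iter_dim h κ hσ hN hR hm hy hk2
  refine hit.add ((tendsto_magField h κ hσ hit fun ht' => ?_).const_mul _)
  exact (iter_second hσ hN hR hm
    (le_floor_of_half_le hN (ht'.trans (floor_le_mul hN ht.1))) hk2).1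

/-- The limiting scheme at the end of the first phase is strictly increasing in its initial value,
so that it vanishes for at most one initial value. -/
lemma strictMono_iter_half (h κ σ : ℝ) {N : ℕ} (hN : 2 ≤ N) :
    StrictMono fun m => iterR (limField h κ σ) (1 / (2 * (N : ℝ))) m N := by
  have hpre : ∀ k, k + 1 ≤ N →
      StrictMono fun m => iterR (limField h κ σ) (1 / (2 * (N : ℝ))) m k := by
    intro k
    induction k with
    | zero => exact fun _ => strictMono_id
    | succ k ih =>
      intro hk x y hxy
      have ih' := ih (by omega) hxy
      simp only at ih' ⊢
      have hkN : (k : ℝ) + 2 ≤ N := by exact_mod_cast hk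
      rw [iterR_limField_succ h κ σ (show k < N by omega),
        iterR_limField_succ h κ σ (show k < N by omega)]
      have hd : 0 < (N : ℝ) - k := by linarith
      have h1 : 0 < 1 - 1 / ((N : ℝ) - k) := by
        rw [sub_pos, div_lt_one hd]; linarith
      have h2 := strictMono_tanh.monotone (add_le_add_right (mul_le_mul_of_nonneg_left ih'.le
        (show 0 ≤ k * N / ((N : ℝ) - k) ^ 2 by positivity)) h)
      exact add_lt_add_of_lt_of_le (mul_lt_mul_of_pos_left ih' h1)
        (mul_le_mul_of_nonneg_left h2 (by positivity))
  intro x y hxy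
  obtain ⟨n, rfl⟩ : ∃ n, N = n + 1 := ⟨N - 1, by omega⟩
  have h1 := hpre n le_rfl hxy
  simp only at h1 ⊢
  rw [iterR_limField_succ h κ σ (Nat.lt_succ_self n),
    iterR_limField_succ h κ σ (Nat.lt_succ_self n)]
  have e : ((n + 1 : ℕ) : ℝ) - n = 1 := by push_cast; ring
  rw [e]
  simp only [div_one, sub_self, zero_mul, zero_add, one_mul, one_pow]
  have hn : (0 : ℝ) < n := by
    have : 0 < n := by omega
    exact_mod_cast this
  exact strictMono_tanh (add_lt_add_right (mul_lt_mul_of_pos_left h1 (by positivity)) h)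

lemma ae_iter_half_ne (h κ σ : ℝ) {N : ℕ} (hN : 2 ≤ N) :
    ∀ᵐ m ∂(gaussianReal 0 1), iterR (limField h κ σ) (1 / (2 * (N : ℝ))) m N ≠ 0 := by
  have hsub : {m | iterR (limField h κ σ) (1 / (2 * (N : ℝ))) m N = 0}.Subsingleton :=
    fun x hx y hy => (strictMono_iter_half h κ σ hN).injective (Eq.trans hx (Eq.symm hy))
  have : NullSingletonClass (gaussianReal 0 1) := nullSingletonClass_gaussianReal one_ne_zero
  rw [ae_iff]
  simpa using hsub.measure_zero (gaussianReal 0 1)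

lemma ae_normalCdf_ne (c : ℝ) : ∀ᵐ m ∂(gaussianReal 0 1), normalCdf m ≠ c := by
  have hsub : {m | normalCdf m = c}.Subsingleton :=
    fun x hx y hy => strictMono_normalCdf.injective (Eq.trans hx (Eq.symm hy))
  have : NullSingletonClass (gaussianReal 0 1) := nullSingletonClass_gaussianReal one_ne_zero
  rw [ae_iff]
  simpa using hsub.measure_zero (gaussianReal 0 1)

lemma measurable_iterR {g : ℝ → ℝ → ℝ} (hg : ∀ t, Measurable (g t)) (δ : ℝ) (k : ℕ) :
    Measurable fun m => iterR g δ m k := by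
  induction k with
  | zero => exact measurable_id
  | succ k ih => exact ih.add (((hg _).comp ih).const_mul _)

lemma measurable_eulerR {g : ℝ → ℝ → ℝ} (hg : ∀ t, Measurable (g t)) (δ t : ℝ) :
    Measurable fun m => eulerR g δ m t :=
  (measurable_iterR hg δ _).add (((hg _).comp (measurable_iterR hg δ _)).const_mul _)

lemma measurable_magField (h κ σ : ℝ) (d : ℕ) (t : ℝ) : Measurable (magField h κ σ d t) := by
  have := continuous_tanh
  unfold magField
  exact Continuous.measurable (by fun_prop)

lemma measurable_limField (h κ σ t : ℝ) : Measurable (limField h κ σ t) := by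
  have := continuous_tanh
  unfold limField
  split_ifs
  · exact Continuous.measurable (by fun_prop)
  · have : Measurable sgn := Measurable.ite measurableSet_Ioi measurable_const measurable_const
    exact (this.sub measurable_id).const_mul _

/-! ### The orthogonal part -/

lemma tendsto_perp_iter (κ σ : ℝ) {N : ℕ} (hN : 1 ≤ N) {k : ℕ} (hk : k ≤ N) :
    Tendsto (fun d => iterR (fun t y => linCoef κ σ d t * y) (1 / (2 * (N : ℝ))) 1 k) atTop
      (𝓝 (1 - k / N)) := by
  induction k with
  | zero => simp [iterR]
  | succ k ih =>
    have ih' := ih (by omega)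
    have hkN : (k : ℝ) + 1 ≤ N := by exact_mod_cast hk
    have hN' : (0 : ℝ) < N := by positivity
    have ht : (k : ℝ) * (1 / (2 * (N : ℝ))) < 1 / 2 := by
      rw [mul_one_div, div_lt_iff₀ (by positivity)]; linarith
    have h1 := ih'.add (((tendsto_linCoef_first κ σ ht).mul ih').const_mul (1 / (2 * (N : ℝ))))
    have hd : (N : ℝ) - k ≠ 0 := by linarith
    have e2 : 1 / 2 - (k : ℝ) * (1 / (2 * (N : ℝ))) = (N - k) / (2 * N) := by field_simp
    have e : 1 - (k : ℝ) / N + 1 / (2 * (N : ℝ)) * (-1 / (1 / 2 - k * (1 / (2 * (N : ℝ)))) *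
        (1 - k / N)) = 1 - ((k + 1 : ℕ) : ℝ) / N := by
      rw [e2]; push_cast; field_simp; ring
    rw [e] at h1
    exact h1

/-- In the limit of infinite dimension, the Euler scheme for the orthogonal part is exact in the
first phase, because the limiting solution is linear in time. -/
lemma tendsto_perp_first (κ σ : ℝ) {N : ℕ} (hN : 1 ≤ N) {t : ℝ} (ht : t ∈ Set.Icc (0 : ℝ) (1 / 2)) :
    Tendsto (fun d => eulerR (fun t y => linCoef κ σ d t * y) (1 / (2 * (N : ℝ))) 1 t) atTop
      (𝓝 (1 - 2 * t)) := by
  have hN' : (0 : ℝ) < N := by positivity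
  rcases eq_or_lt_of_le ht.2 with rfl | hlt
  · simp_rw [eulerR_half hN]
    convert tendsto_perp_iter κ σ hN le_rfl using 2
    field_simp
  have hle := floor_le_mul hN ht.1
  set k := ⌊t / (1 / (2 * (N : ℝ)))⌋₊ with hk
  have hgrid : (k : ℝ) * (1 / (2 * (N : ℝ))) < 1 / 2 := hle.trans_lt hlt
  have hkN : (k : ℝ) < N := by
    rw [mul_one_div, div_lt_iff₀ (by positivity)] at hgrid; linarith
  have hkN' : k ≤ N := by exact_mod_cast hkN.le
  have h0 := tendsto_perp_iter κ σ hN hkN'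
  have h1 := h0.add (((tendsto_linCoef_first κ σ hgrid).mul h0).const_mul
    (t - k * (1 / (2 * (N : ℝ)))))
  have hd : (N : ℝ) - k ≠ 0 := by linarith
  have e2 : 1 / 2 - (k : ℝ) * (1 / (2 * (N : ℝ))) = (N - k) / (2 * N) := by field_simp
  have e : 1 - (k : ℝ) / N + (t - k * (1 / (2 * (N : ℝ)))) *
      (-1 / (1 / 2 - k * (1 / (2 * (N : ℝ)))) * (1 - k / N)) = 1 - 2 * t := by
    rw [e2]; field_simp; ring
  rw [e] at h1
  exact h1

/-- The standard deviation of the orthogonal part at the start of the second phase. -/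
lemma tendsto_perp_half (κ σ : ℝ) {N : ℕ} (hN : 1 ≤ N) :
    Tendsto (fun d : ℕ => √(d : ℝ) *
      iterR (fun t y => linCoef κ σ d t * y) (1 / (2 * (N : ℝ))) 1 N) atTop (𝓝 κ) := by
  obtain ⟨n, rfl⟩ : ∃ n, N = n + 1 := ⟨N - 1, by omega⟩
  have hn : (0 : ℝ) ≤ n := by positivity
  have ht : (n : ℝ) * (1 / (2 * ((n + 1 : ℕ) : ℝ))) < 1 / 2 := by
    push_cast
    rw [mul_one_div, div_lt_iff₀ (by positivity)]; linarith
  have h1 := (tendsto_perp_iter κ σ hN (Nat.le_succ n)).mul (tendsto_last_factor κ σ ht)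
  have e : (1 - (n : ℝ) / ((n + 1 : ℕ) : ℝ)) *
      (κ / (1 - 2 * (n * (1 / (2 * ((n + 1 : ℕ) : ℝ)))))) = κ := by
    have : (n : ℝ) + 1 ≠ 0 := by positivity
    have e3 : 1 - 2 * ((n : ℝ) * (1 / (2 * ((n + 1 : ℕ) : ℝ)))) = 1 / (n + 1) := by
      push_cast; field_simp; ring
    rw [e3]; push_cast; field_simp; ring
  rw [e] at h1
  refine h1.congr fun d => ?_
  have e4 : 1 / 2 - (n : ℝ) * (1 / (2 * ((n + 1 : ℕ) : ℝ))) = 1 / (2 * ((n + 1 : ℕ) : ℝ)) := by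
    push_cast; field_simp; ring
  rw [e4]
  simp only [iterR]
  ring

/-- The Euler iterates of the limiting linear equation of the second phase, started from `κ` at the
index `N`; the first `N` values are immaterial. -/
def perpIter (κ σ : ℝ) (N : ℕ) : ℕ → ℝ
  | 0 => κ
  | k + 1 => if k < N then κ else
      perpIter κ σ N k + 1 / (2 * (N : ℝ)) *
        (-rate κ σ (k * (1 / (2 * (N : ℝ)))) * perpIter κ σ N k)

lemma perpIter_start (κ σ : ℝ) (N : ℕ) : perpIter κ σ N N = κ := by
  cases N with
  | zero => rfl
  | succ n => rw [perpIter, if_pos (Nat.lt_succ_self n)]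

lemma tendsto_perp_iter_second (κ : ℝ) {σ : ℝ} (hσ : 0 < σ) {N : ℕ} (hN : 1 ≤ N) {k : ℕ}
    (hk : N ≤ k) : Tendsto (fun d : ℕ => √(d : ℝ) *
      iterR (fun t y => linCoef κ σ d t * y) (1 / (2 * (N : ℝ))) 1 k) atTop
      (𝓝 (perpIter κ σ N k)) := by
  induction k, hk using Nat.le_induction with
  | base => rw [perpIter_start]; exact tendsto_perp_half κ σ hN
  | succ k hk ih =>
    have h1 := ih.add (((tendsto_linCoef_second κ hσ (half_le_grid hN hk)).mul ih).const_mul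
      (1 / (2 * (N : ℝ))))
    rw [perpIter, if_neg (not_lt.2 hk)]
    refine h1.congr fun d => ?_
    rw [iterR]; ring

/-- The limiting standard deviation of the orthogonal part in the second phase. -/
def perpStd (κ σ t : ℝ) : ℝ := κ * √((κ ^ 2 * (2 - 2 * t) ^ 2 + σ ^ 2) / (κ ^ 2 + σ ^ 2))

lemma perpStd_half {κ σ : ℝ} (hσ : 0 < σ) : perpStd κ σ (1 / 2) = κ := by
  have : κ ^ 2 + σ ^ 2 ≠ 0 := by positivity
  rw [perpStd]
  norm_num [div_self this]

lemma hasDerivAt_perpStd (κ : ℝ) {σ : ℝ} (hσ : 0 < σ) (t : ℝ) :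
    HasDerivAt (perpStd κ σ) (-rate κ σ t * perpStd κ σ t) t := by
  have hD : 0 < κ ^ 2 + σ ^ 2 := by positivity
  have hpos := limDen_pos (κ := κ) hσ t
  have hQ : 0 < (κ ^ 2 * (2 - 2 * t) ^ 2 + σ ^ 2) / (κ ^ 2 + σ ^ 2) := div_pos hpos hD
  have h1 : HasDerivAt (fun t : ℝ => (κ ^ 2 * (2 - 2 * t) ^ 2 + σ ^ 2) / (κ ^ 2 + σ ^ 2))
      (κ ^ 2 * (2 * (2 - 2 * t) * (-2)) / (κ ^ 2 + σ ^ 2)) t := by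
    have hl : HasDerivAt (fun t : ℝ => 2 - 2 * t) (-2) t := by
      simpa using ((hasDerivAt_id t).const_mul 2).const_sub 2
    have := (((hl.pow 2).const_mul (κ ^ 2)).add_const (σ ^ 2)).div_const (κ ^ 2 + σ ^ 2)
    simpa using this
  have h2 := (h1.sqrt hQ.ne').const_mul κ
  refine h2.congr_deriv ?_
  have hs := Real.sq_sqrt hQ.le
  have hs0 := (Real.sqrt_pos.2 hQ).ne'
  rw [perpStd, rate]
  set w := √((κ ^ 2 * (2 - 2 * t) ^ 2 + σ ^ 2) / (κ ^ 2 + σ ^ 2))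
  have hw : w ^ 2 * (κ ^ 2 + σ ^ 2) = κ ^ 2 * (2 - 2 * t) ^ 2 + σ ^ 2 := by
    rw [hs]; field_simp
  rw [← hw]
  field_simp

/-- The limit of small step size for the orthogonal part in the second phase. -/
lemma tendsto_perp_second (κ : ℝ) {σ : ℝ} (hσ : 0 < σ) {t : ℝ} (ht : t ∈ Set.Icc (1 / 2 : ℝ) 1) :
    Tendsto (fun N : ℕ => perpIter κ σ N ⌊t / (1 / (2 * (N : ℝ)))⌋₊ +
      (t - ⌊t / (1 / (2 * (N : ℝ)))⌋₊ * (1 / (2 * (N : ℝ)))) *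
        (-rate κ σ (⌊t / (1 / (2 * (N : ℝ)))⌋₊ * (1 / (2 * (N : ℝ)))) *
          perpIter κ σ N ⌊t / (1 / (2 * (N : ℝ)))⌋₊)) atTop (𝓝 (perpStd κ σ t)) := by
  have hK : 0 ≤ 2 * κ ^ 2 / σ ^ 2 := by positivity
  have hlip : ∀ s ∈ Set.Icc (1 / 2 : ℝ) 1, ∀ u v,
      |-rate κ σ s * u - -rate κ σ s * v| ≤ 2 * κ ^ 2 / σ ^ 2 * |u - v| := by
    intro s hs u v
    rw [← mul_sub, abs_mul, abs_neg, abs_of_nonneg (rate_nonneg hs.2)]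
    exact mul_le_mul_of_nonneg_right (rate_le hσ hs.1) (abs_nonneg _)
  have hy : ∀ s ∈ Set.Icc (1 / 2 : ℝ) 1,
      HasDerivWithinAt (perpStd κ σ) (-rate κ σ s * perpStd κ σ s) (Set.Icc (1 / 2) 1) s :=
    fun s _ => (hasDerivAt_perpStd κ hσ s).hasDerivWithinAt
  have hc : ContinuousOn (fun s => -rate κ σ s * perpStd κ σ s) (Set.Icc (1 / 2 : ℝ) 1) := by
    have h1 : Continuous (perpStd κ σ) :=
      continuous_iff_continuousAt.2 fun s => (hasDerivAt_perpStd κ hσ s).continuousAt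
    have h2 : Continuous (rate κ σ) := by
      unfold rate
      exact Continuous.div (by fun_prop) (by fun_prop) fun s => (limDen_pos hσ s).ne'
    exact (h2.neg.mul h1).continuousOn
  rw [Metric.tendsto_nhds]
  intro ε hε
  obtain ⟨η, hη, H⟩ := euler_converges (g := fun s u => -rate κ σ s * u) hK (by norm_num) hlip hy hc
    (half_pos hε)
  have hlim : Tendsto (fun N : ℕ => 1 / (2 * (N : ℝ))) atTop (𝓝 0) :=
    tendsto_const_nhds.div_atTop (tendsto_natCast_atTop_atTop.const_mul_atTop two_pos)
  filter_upwards [hlim.eventually (eventually_lt_nhds hη), eventually_ge_atTop 1] with N hN hN1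
  have hN' : (N : ℝ) ≠ 0 := by positivity
  have := H _ (by positivity) hN (perpIter κ σ N) N (by field_simp)
    ((perpIter_start κ σ N).trans (perpStd_half hσ).symm)
    (fun k hk => by rw [perpIter, if_neg (not_lt.2 hk)]) t ht _ (le_floor_of_half_le hN1 ht.1)
    (floor_le_mul hN1 (by linarith [ht.1])) (lt_floor_mul hN1 t).le
  rw [Real.dist_eq]
  exact this.trans_lt (half_lt_self hε)

lemma tendsto_perpStd_one {σ : ℝ} (hσ : 0 < σ) :
    Tendsto (fun κ => perpStd κ σ 1) atTop (𝓝 σ) := by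
  have h1 : Tendsto (fun κ : ℝ => σ ^ 2 / κ ^ 2) atTop (𝓝 0) :=
    tendsto_const_nhds.div_atTop (tendsto_pow_atTop two_ne_zero)
  have h2 : Tendsto (fun κ : ℝ => √(σ ^ 2 / (1 + σ ^ 2 / κ ^ 2))) atTop (𝓝 √(σ ^ 2 / (1 + 0))) :=
    (Real.continuous_sqrt.tendsto _).comp
      (tendsto_const_nhds.div (h1.const_add 1) (by norm_num))
  rw [add_zero, div_one, Real.sqrt_sq hσ.le] at h2
  refine h2.congr' ?_
  filter_upwards [eventually_gt_atTop 0] with κ hκ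
  rw [perpStd]
  nth_rewrite 2 [← Real.sqrt_sq hκ.le]
  rw [← Real.sqrt_mul (sq_nonneg κ)]
  congr 1
  field_simp
  ring

/-! ### The iterated limits -/

lemma iterLim_mag {p σ h : ℝ} (hσ : 0 < σ) (hp : p = Real.exp h / (Real.exp h + Real.exp (-h)))
    (hp0 : 0 < p) (hp1 : p < 1) (r : ∀ d : ℕ, Vec d) (hr : ∀ d : ℕ, ‖r d‖ ^ 2 = (d : ℝ)) (κ : ℝ)
    {m : ℝ} (hm : normalCdf m ≠ 1 - p)
    (hm0 : ∀ N : ℕ, 2 ≤ N → iterR (limField h κ σ) (1 / (2 * (N : ℝ))) m N ≠ 0)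
    {x : ∀ d : ℕ, Vec d} (hx : Tendsto (fun d => mag (r d) (x d)) atTop (𝓝 m))
    {t : ℝ} (ht : t ∈ Set.Icc (0 : ℝ) 1) :
    IterLim (fun N d => mag (r d) (flow p σ κ (r d) N (x d) t)) (limMag p m t) := by
  refine ⟨_, ?_, tendsto_euler_limMag hp hp0 hp1 κ hσ hm ht⟩
  filter_upwards [eventually_ge_atTop 2,
    tendsto_natCast_atTop_atTop.eventually_ge_atTop (κ ^ 2 / σ ^ 2)] with N hN hR
  refine (tendsto_euler_dim h κ hσ (by omega) hR (hm0 N hN) hx ht).congr' ?_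
  filter_upwards [eventually_ge_atTop 1] with d hd
  rw [mag_flow hd hσ hp κ (hr d)]

/-- The iterated limit in law: the magnetization of the Euler path is a function of that of its starting
point, which is standard Gaussian in every dimension, so dominated convergence applies twice. -/
lemma iterLim_law {p σ h : ℝ} (hσ : 0 < σ) (hp : p = Real.exp h / (Real.exp h + Real.exp (-h)))
    (hp0 : 0 < p) (hp1 : p < 1) (r : ∀ d : ℕ, Vec d) (hr : ∀ d : ℕ, ‖r d‖ ^ 2 = (d : ℝ)) (κ : ℝ)
    {n : ℕ} (t : Fin n → ℝ) (ht : ∀ i, t i ∈ Set.Icc (0 : ℝ) 1)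
    (f : BoundedContinuousFunction (Fin n → ℝ) ℝ) :
    IterLim (fun N d => ∫ x, f (fun i => mag (r d) (flow p σ κ (r d) N x (t i)))
        ∂(isoGaussian (0 : Vec d) √(d : ℝ)))
      (∫ m, f (fun i => limMag p m (t i)) ∂(gaussianReal 0 1)) := by
  have hbound : ∀ y, ‖f y‖ ≤ ‖f‖ := fun y => f.norm_coe_le_norm y
  have hmeas : ∀ g : ℝ → ℝ → ℝ, (∀ s, Measurable (g s)) → ∀ δ : ℝ,
      AEStronglyMeasurable (fun m => f (fun i => eulerR g δ m (t i))) (gaussianReal 0 1) := by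
    intro g hg δ
    exact (f.continuous.measurable.comp
      (measurable_pi_lambda _ fun i => measurable_eulerR hg δ (t i))).aestronglyMeasurable
  refine ⟨fun N => ∫ m, f (fun i => eulerR (limField h κ σ) (1 / (2 * (N : ℝ))) m (t i))
    ∂(gaussianReal 0 1), ?_, ?_⟩
  · filter_upwards [eventually_ge_atTop 2,
      tendsto_natCast_atTop_atTop.eventually_ge_atTop (κ ^ 2 / σ ^ 2)] with N hN hR
    have hdct : Tendsto (fun d : ℕ => ∫ m, f (fun i =>
        eulerR (magField h κ σ d) (1 / (2 * (N : ℝ))) m (t i)) ∂(gaussianReal 0 1)) atTop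
        (𝓝 (∫ m, f (fun i => eulerR (limField h κ σ) (1 / (2 * (N : ℝ))) m (t i))
          ∂(gaussianReal 0 1))) := by
      refine tendsto_integral_of_dominated_convergence (fun _ => ‖f‖)
        (fun d => hmeas _ (measurable_magField h κ σ d) _) (integrable_const _)
        (fun d => ae_of_all _ fun m => hbound _) ?_
      filter_upwards [ae_iter_half_ne h κ σ hN] with m hm
      refine (f.continuous.tendsto _).comp (tendsto_pi_nhds.2 fun i => ?_)
      exact tendsto_euler_dim h κ hσ (by omega) hR hm tendsto_const_nhds (ht i)
    refine hdct.congr' ?_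
    filter_upwards [eventually_ge_atTop 1] with d hd
    have hmag : Measurable (mag (r d)) := by unfold mag; fun_prop
    rw [← map_mag hd (hr d), integral_map hmag.aemeasurable]
    · simp_rw [mag_flow hd hσ hp κ (hr d)]
    · rw [map_mag hd (hr d)]
      exact hmeas _ (measurable_magField h κ σ d) _
  · refine tendsto_integral_of_dominated_convergence (fun _ => ‖f‖)
      (fun N => hmeas _ (measurable_limField h κ σ) _) (integrable_const _)
      (fun N => ae_of_all _ fun m => hbound _) ?_
    filter_upwards [ae_normalCdf_ne (1 - p)] with m hm
    refine (f.continuous.tendsto _).comp (tendsto_pi_nhds.2 fun i => ?_)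
    exact tendsto_euler_limMag hp hp0 hp1 κ hσ hm (ht i)

lemma iterLim_perp_first (κ σ : ℝ) {t : ℝ} (ht : t ∈ Set.Icc (0 : ℝ) (1 / 2)) :
    IterLim (fun N d => |eulerR (fun t y => linCoef κ σ d t * y) (1 / (2 * (N : ℝ))) 1 t|)
      (1 - 2 * t) := by
  refine ⟨fun _ => 1 - 2 * t, ?_, tendsto_const_nhds⟩
  filter_upwards [eventually_ge_atTop 1] with N hN
  have := (tendsto_perp_first κ σ hN ht).abs
  rwa [abs_of_nonneg (by linarith [ht.2])] at this

lemma iterLim_perp_second {κ σ : ℝ} (hκ : 0 < κ) (hσ : 0 < σ) {t : ℝ}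
    (ht : t ∈ Set.Icc (1 / 2 : ℝ) 1) :
    IterLim (fun N d => √(d : ℝ) *
        |eulerR (fun t y => linCoef κ σ d t * y) (1 / (2 * (N : ℝ))) 1 t|)
      (perpStd κ σ t) := by
  have h1 := (tendsto_perp_second κ hσ ht).abs
  have hnn : 0 ≤ perpStd κ σ t := by unfold perpStd; positivity
  rw [abs_of_nonneg hnn] at h1
  refine ⟨_, ?_, h1⟩
  filter_upwards [eventually_ge_atTop 1] with N hN
  have hk := le_floor_of_half_le hN ht.1
  have h2 := tendsto_perp_iter_second κ hσ hN hk
  have h3 := (h2.add (((tendsto_linCoef_second κ hσ (half_le_grid hN hk)).mul h2).const_mul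
    (t - ⌊t / (1 / (2 * (N : ℝ)))⌋₊ * (1 / (2 * (N : ℝ)))))).abs
  refine h3.congr fun d => ?_
  conv_rhs => rw [← abs_of_nonneg (Real.sqrt_nonneg (d : ℝ)), ← abs_mul]
  congr 1
  rw [eulerR]
  ring

end DilatedVE

end

theorem theorem2 (p σ h : ℝ) (hσ : 0 < σ)
    (hp : p = Real.exp h / (Real.exp h + Real.exp (-h)))
    (r : ∀ d : ℕ, Vec d) (hr : ∀ d : ℕ, ‖r d‖ ^ 2 = (d : ℝ)) :
    ∃ σlim : ℝ → ℝ → ℝ,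
      (∀ κ : ℝ, 0 < κ →
        -- the limiting magnetization, as a function of its initial value `m` and of time
        (∃ M : ℝ → ℝ → ℝ,
          (∀ t ∈ Set.Icc (0 : ℝ) 1, AEMeasurable (fun m => M m t) (gaussianReal 0 1)) ∧
          -- `M_t` is the iterated limit, realization by realization
          (∀ᵐ m ∂(gaussianReal 0 1), ∀ x : ∀ d : ℕ, Vec d,
            Tendsto (fun d => mag (r d) (x d)) atTop (𝓝 m) →
            ∀ t ∈ Set.Icc (0 : ℝ) 1,
              IterLim (fun N d => mag (r d) (flow p σ κ (r d) N (x d) t)) (M m t)) ∧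
          -- `M_t` is the iterated limit in law, jointly at finitely many times
          (∀ (n : ℕ) (t : Fin n → ℝ), (∀ i, t i ∈ Set.Icc (0 : ℝ) 1) →
            ∀ f : BoundedContinuousFunction (Fin n → ℝ) ℝ,
              IterLim
                (fun N d => ∫ x, f (fun i => mag (r d) (flow p σ κ (r d) N x (t i)))
                  ∂(isoGaussian (0 : Vec d) √(d : ℝ)))
                (∫ m, f (fun i => M m (t i)) ∂(gaussianReal 0 1))) ∧
          -- first phase: the limiting ODE, started from `M_0 ∼ N(0, 1)`
          (∀ᵐ m ∂(gaussianReal 0 1), M m 0 = m ∧ ContinuousOn (M m) (Set.Icc 0 1) ∧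
            ∀ t ∈ Set.Ico (0 : ℝ) (1 / 2),
              HasDerivWithinAt (M m)
                ((-(M m t) + Real.tanh (h + 2 * t * M m t / (1 - 2 * t) ^ 2)) / (1 / 2 - t))
                (Set.Icc 0 1) t) ∧
          (gaussianReal 0 1).map (fun m => M m (1 / 2)) =
            ENNReal.ofReal p • Measure.dirac (1 : ℝ) +
              ENNReal.ofReal (1 - p) • Measure.dirac (-1 : ℝ) ∧
          -- second phase: the magnetization stays constant
          (∀ᵐ m ∂(gaussianReal 0 1), ∀ t ∈ Set.Icc (1 / 2 : ℝ) 1, M m t = M m (1 / 2))) ∧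
        -- first phase: the orthogonal part
        (∃ s : ℕ → ℕ → ℝ → ℝ, (∀ N d t, 0 ≤ s N d t) ∧
          (∀ N d : ℕ, 1 ≤ N → 1 ≤ d → ∀ t ∈ Set.Icc (0 : ℝ) (1 / 2),
            (isoGaussian (0 : Vec d) √(d : ℝ)).map
                (fun x => perp (r d) (flow p σ κ (r d) N x t)) =
              perpGaussian (r d) (√(d : ℝ) * s N d t)) ∧
          (∀ t ∈ Set.Icc (0 : ℝ) (1 / 2), IterLim (fun N d => s N d t) (1 - 2 * t))) ∧
        -- second phase: the orthogonal part
        (∃ s : ℕ → ℕ → ℝ → ℝ, (∀ N d t, 0 ≤ s N d t) ∧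
          (∀ N d : ℕ, 1 ≤ N → 1 ≤ d → ∀ t ∈ Set.Icc (1 / 2 : ℝ) 1,
            (isoGaussian (0 : Vec d) √(d : ℝ)).map
                (fun x => perp (r d) (flow p σ κ (r d) N x t)) =
              perpGaussian (r d) (s N d t)) ∧
          (∀ t ∈ Set.Icc (1 / 2 : ℝ) 1, IterLim (fun N d => s N d t) (σlim κ t))) ∧
        (∀ t ∈ Set.Icc (1 / 2 : ℝ) 1,
          σlim κ t = κ * √((κ ^ 2 * (2 - 2 * t) ^ 2 + σ ^ 2) / (κ ^ 2 + σ ^ 2)))) ∧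
      Tendsto (fun κ => σlim κ 1) atTop (𝓝 σ) := by
  have hp0 : 0 < p := by rw [hp]; positivity
  have hp1 : p < 1 := by
    rw [hp]; exact (div_lt_one (by positivity)).2 (by linarith [Real.exp_pos (-h)])
  refine ⟨fun κ t => perpStd κ σ t, fun κ hκ => ⟨⟨fun m t => limMag p m t, ?_, ?_, ?_, ?_, ?_, ?_⟩,
    ?_, ?_, fun t _ => rfl⟩, tendsto_perpStd_one hσ⟩
  · exact fun t _ => (measurable_limMag hp0 hp1 t).aemeasurable
  · have hnull : ∀ᵐ m ∂(gaussianReal 0 1), ∀ N : ℕ, 2 ≤ N →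
        iterR (limField h κ σ) (1 / (2 * (N : ℝ))) m N ≠ 0 := by
      rw [ae_all_iff]
      intro N
      by_cases hN : 2 ≤ N
      · filter_upwards [ae_iter_half_ne h κ σ hN] with m hm _ using hm
      · exact ae_of_all _ fun m hN' => absurd hN' hN
    filter_upwards [ae_normalCdf_ne (1 - p), hnull] with m hm hm0 x hx t ht
    exact iterLim_mag hσ hp hp0 hp1 r hr κ hm hm0 hx ht
  · exact fun n t ht f => iterLim_law hσ hp hp0 hp1 r hr κ t ht f
  · filter_upwards [ae_normalCdf_ne (1 - p)] with m hm
    exact ⟨limMag_zero hp0 hp1 m, (continuous_limMag hp hp0 hp1 hm).continuousOn,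
      fun t ht => (hasDerivAt_limMag hp hp0 hp1 m ht.2).hasDerivWithinAt⟩
  · exact map_limMag_half hp0 hp1
  · exact ae_of_all _ fun m t ht => limMag_half ht.1
  · refine ⟨fun N d t => |eulerR (fun t y => linCoef κ σ d t * y) (1 / (2 * (N : ℝ))) 1 t|,
      fun N d t => abs_nonneg _, fun N d _ hd t _ => ?_, fun t ht => iterLim_perp_first κ σ ht⟩
    simp_rw [perp_flow hd hσ hp κ (hr d)]
    exact map_smul_perp (hr d) _
  · refine ⟨fun N d t => √(d : ℝ) *
        |eulerR (fun t y => linCoef κ σ d t * y) (1 / (2 * (N : ℝ))) 1 t|,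
      fun N d t => mul_nonneg (Real.sqrt_nonneg _) (abs_nonneg _), fun N d _ hd t _ => ?_,
      fun t ht => iterLim_perp_second hκ hσ ht⟩
    simp_rw [perp_flow hd hσ hp κ (hr d)]
    exact map_smul_perp (hr d) _
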